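/- For $n\ge 0$ and $p\in[0,1]$ let $G(n,p)$ be the random graph on $n$ labelled vertices in which each of the $\binom n2$ possible edges is present independently with probability $p$. Let $X(n,p)$ be its clique complex, i.e. the simplicial complex whose faces are the nonempty sets of vertices that span a complete subgraph of $G(n,p)$. For $k\ge 0$ write $\beta_k(X(n,p))=\dim_{\mathbb Q}H_k(X(n,p);\mathbb Q)$ for its $k$-th Betti number. Theorem. Fix an integer $k>0$ and let $p=p(n)\in[0,1]$ satisfy $p=\omega(n^{-1/k})$ and $p=o(n^{-1/(k+1)})$ as $n\to\infty$, that is, $n^{1/k}p(n)\to\infty$ and $n^{1/(k+1)}p(n)\to 0$. Then, as $n\to\infty$, $$\frac{\beta_k(X(n,p))-\mathbb E[\beta_k(X(n,p))]}{\sqrt{\operatorname{Var}[\beta_k(X(n,p))]}}\Rightarrow\mathcal N(0,1),$$ where $\Rightarrow$ denotes weak convergence (convergence in distribution) and $\mathcal N(0,1)$ is the standard normal distribution. -/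

import Mathlib

open Filter MeasureTheory ProbabilityTheory Asymptotics

namespace AbstractSimplicialComplex

variable {V : Type*}

/-- The `k`-dimensional faces of `K`, i.e. the faces with `k + 1` vertices. -/
abbrev Face (K : AbstractSimplicialComplex V) (k : ℕ) : Type _ :=
  {s : Finset V // s ∈ K.faces ∧ s.card = k + 1}

/-- The rational simplicial `k`-chains of `K`. -/
abbrev Chain (K : AbstractSimplicialComplex V) (k : ℕ) : Type _ := K.Face k →₀ ℚ

variable [LinearOrder V]

/-- The facet of a `(k + 1)`-face opposite to one of its vertices. -/
def Face.facet {K : AbstractSimplicialComplex V} {k : ℕ} (s : K.Face (k + 1)) (v : s.1) :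
    K.Face k :=
  ⟨s.1.erase v.1, by
    have hc : (s.1.erase v.1).card = k + 1 := by
      rw [Finset.card_erase_of_mem v.2, s.2.2]; rfl
    exact ⟨(K.isRelLowerSet_faces s.2.1).2 (Finset.erase_subset _ _)
      (Finset.card_pos.1 (by omega)), hc⟩⟩

/-- The sign `(-1)^i` of a vertex `v` of `s`, where `i` is the (zero-based) position of `v` among
the vertices of `s` in increasing order. -/
def vertexSign (s : Finset V) (v : V) : ℚ := (-1) ^ (s.filter (· < v)).card

/-- The simplicial boundary operator `∂ : C_{k+1} → C_k`,
`∂[v_0, …, v_{k+1}] = ∑ i, (-1)^i [v_0, …, v̂_i, …, v_{k+1}]` for `v_0 < … < v_{k+1}`. -/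
noncomputable def boundary (K : AbstractSimplicialComplex V) (k : ℕ) :
    K.Chain (k + 1) →ₗ[ℚ] K.Chain k :=
  Finsupp.linearCombination ℚ fun s : K.Face (k + 1) =>
    ∑ v : s.1, Finsupp.single (s.facet v) (vertexSign s.1 v.1)

/-- The `k`-cycles; every `0`-chain is a cycle (unreduced homology). -/
noncomputable def cycles (K : AbstractSimplicialComplex V) : (k : ℕ) → Submodule ℚ (K.Chain k)
  | 0 => ⊤
  | k + 1 => LinearMap.ker (K.boundary k)

/-- The `k`-boundaries. -/
noncomputable def boundaries (K : AbstractSimplicialComplex V) (k : ℕ) :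
    Submodule ℚ (K.Chain k) :=
  LinearMap.range (K.boundary k)

theorem vertexSign_erase (s : Finset V) (v w : V) (hv : v ∈ s) (hvw : v < w) :
    vertexSign s v * vertexSign (s.erase v) w = -(vertexSign s w * vertexSign (s.erase w) v) := by
  have h1 : (s.erase v).filter (· < w) = (s.filter (· < w)).erase v := by
    ext x; simp only [Finset.mem_filter, Finset.mem_erase]; tauto
  have h2 : (s.erase w).filter (· < v) = s.filter (· < v) := by
    ext x; simp only [Finset.mem_filter, Finset.mem_erase]
    constructor
    · tauto
    · rintro ⟨hx, hxv⟩
      exact ⟨⟨(hxv.trans hvw).ne, hx⟩, hxv⟩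
  have hm : v ∈ s.filter (· < w) := Finset.mem_filter.2 ⟨hv, hvw⟩
  have h3 := Finset.card_erase_add_one hm
  unfold vertexSign
  rw [h1, h2, ← h3, pow_succ]
  ring

/-- The boundary of a boundary vanishes. -/
theorem boundary_comp_boundary (K : AbstractSimplicialComplex V) (k : ℕ) :
    K.boundary k ∘ₗ K.boundary (k + 1) = 0 := by
  ext1 s
  ext1
  simp only [LinearMap.coe_comp, Function.comp_apply, Finsupp.lsingle_apply, boundary,
    Finsupp.linearCombination_single, one_smul, map_sum, LinearMap.zero_apply,
    LinearMap.zero_comp, Finset.smul_sum, Finsupp.smul_single, smul_eq_mul]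
  rw [Finset.sum_sigma']
  refine Finset.sum_involution
    (fun x _ => ⟨⟨x.2.1, Finset.mem_of_mem_erase x.2.2⟩,
      ⟨x.1.1, Finset.mem_erase.2 ⟨(Finset.ne_of_mem_erase x.2.2).symm, x.1.2⟩⟩⟩)
    ?_ ?_ (fun _ _ => Finset.mem_sigma.2 ⟨Finset.mem_univ _, Finset.mem_univ _⟩)
    (fun _ _ => rfl)
  · rintro ⟨v, w⟩ _
    have hne : w.1 ≠ v.1 := Finset.ne_of_mem_erase w.2
    have hw : w.1 ∈ s.1 := Finset.mem_of_mem_erase w.2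
    have hf : (s.facet ⟨w.1, hw⟩).facet ⟨v.1, Finset.mem_erase.2 ⟨hne.symm, v.2⟩⟩ =
        (s.facet v).facet w := Subtype.ext Finset.erase_right_comm
    dsimp only
    rw [hf, ← Finsupp.single_add]
    have key : vertexSign s.1 v.1 * vertexSign (s.1.erase v.1) w.1 =
        -(vertexSign s.1 w.1 * vertexSign (s.1.erase w.1) v.1) := by
      rcases lt_or_gt_of_ne hne with h | h
      · rw [vertexSign_erase s.1 w.1 v.1 hw h, neg_neg]
      · exact vertexSign_erase s.1 v.1 w.1 v.2 h
    change Finsupp.single _ (vertexSign s.1 v.1 * vertexSign (s.1.erase v.1) w.1 +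
      vertexSign s.1 w.1 * vertexSign (s.1.erase w.1) v.1) = 0
    rw [key, neg_add_cancel, Finsupp.single_zero]
  · rintro ⟨v, w⟩ _ _ h
    have h1 := congrArg (fun x => (x.1 : V)) h
    exact Finset.ne_of_mem_erase w.2 h1

theorem boundaries_le_cycles (K : AbstractSimplicialComplex V) (k : ℕ) :
    K.boundaries k ≤ K.cycles k := by
  cases k with
  | zero => exact le_top
  | succ k =>
    rintro _ ⟨x, rfl⟩
    exact LinearMap.congr_fun (K.boundary_comp_boundary k) x

/-- The `k`-th simplicial homology `H_k(K; ℚ)`. -/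
abbrev Homology (K : AbstractSimplicialComplex V) (k : ℕ) : Type _ :=
  K.cycles k ⧸ (K.boundaries k).submoduleOf (K.cycles k)

/-- The `k`-th Betti number `dim H_k(K; ℚ)`. -/
noncomputable def betti (K : AbstractSimplicialComplex V) (k : ℕ) : ℕ :=
  Module.finrank ℚ (K.Homology k)

end AbstractSimplicialComplex

/-- The clique complex of a graph: its faces are the nonempty finite sets of vertices that span a
complete subgraph. -/
def SimpleGraph.cliqueComplex {V : Type*} (G : SimpleGraph V) : AbstractSimplicialComplex V where
  faces := {s | s.Nonempty ∧ G.IsClique (s : Set V)}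
  isRelLowerSet_faces := fun _ hs =>
    ⟨hs.1, fun _ hts ht => ⟨ht, hs.2.subset (Finset.coe_subset.2 hts)⟩⟩
  singleton_mem v := ⟨Finset.singleton_nonempty v, by simp⟩

/-- `β_k` of the clique complex, as a real-valued function of a graph on `n` vertices; under
`SimpleGraph.binomialRandom (Fin n) p` it is the random variable `β_k(X(n, p))`. -/
noncomputable def cliqueBetti (n k : ℕ) (G : SimpleGraph (Fin n)) : ℝ :=
  (G.cliqueComplex.betti k : ℝ)

/-!
Let `f j` be the number of `j`-faces of the clique complex, and let `Z j` and `R j` be the nullity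
and the rank of its `j`-th boundary map, so that `β k = Z k - R (k + 1)` and `f k = Z k + R k`. Let
`m` be the expected change of `f k` when a fixed edge is inserted. By the Efron–Stein inequality,
the variance of `β k - m * #edges` is at most `p` times the sum over the edges of the second moments
of the discrete derivatives, and each of these is small compared with `m ^ 2`:

* the derivative of `f k` concentrates around `m`, by counting pairs of overlapping cliques;
* the derivative of `R (k + 1)` is at most that of `f (k + 1)`, which is negligible because
  `n * p ^ (k + 1)` tends to zero;
* the derivative of `R k` is small on average, because `Z k` is a supermodular function of the edge
  set: its expectation is a convex function of `p` squeezed between those of `f k - f (k - 1)` and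
  `f k`, which pins down its slope.

Hence the normalized Betti number is `L²`-close to the normalized number of edges, for which the
central limit theorem is that of de Moivre and Laplace.
-/

section SetFunction

open Finset

variable {α G : Type*} [DecidableEq α] [AddCommGroup G]

/-- The discrete derivative of a set function in the direction of an element: the effect of
inserting the element, whether or not it is already present. -/
def discreteDeriv (e : α) (F : Finset α → G) (S : Finset α) : G :=
  F (insert e S) - F (S.erase e)

theorem discreteDeriv_comp_insert {a e : α} (hae : a ≠ e) (F : Finset α → G) (S : Finset α) :
    discreteDeriv e (fun T => F (insert a T)) S = discreteDeriv e F (insert a S) := by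
  simp only [discreteDeriv]
  rw [erase_insert_of_ne hae, insert_comm]

theorem discreteDeriv_add (e : α) (F F' : Finset α → G) (S : Finset α) :
    discreteDeriv e (fun T => F T + F' T) S = discreteDeriv e F S + discreteDeriv e F' S :=
  add_sub_add_comm _ _ _ _

theorem discreteDeriv_nonneg_of_monotone {F : Finset α → ℝ} (hF : Monotone F) (e : α)
    (S : Finset α) : 0 ≤ discreteDeriv e F S :=
  sub_nonneg.2 (hF ((erase_subset e S).trans (subset_insert e S)))

theorem discreteDeriv_sub_const_mul_card (F : Finset α → ℝ) (c : ℝ) (e : α) (S : Finset α) :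
    discreteDeriv e (fun T => F T - c * #T) S = discreteDeriv e F S - c := by
  have card_insert : (#(insert e S) : ℝ) = #(S.erase e) + 1 := by
    rw [← card_erase_add_one (mem_insert_self e S), erase_insert_eq_erase, Nat.cast_succ]
  simp only [discreteDeriv, card_insert]
  ring

/-- Supermodularity of a real set function, the discrete analogue of convexity which makes
`bernoulliMean U x F` convex in `x`. -/
def IsSupermodular (F : Finset α → ℝ) : Prop :=
  ∀ S T, F S + F T ≤ F (S ∪ T) + F (S ∩ T)

theorem IsSupermodular.comp_insert {F : Finset α → ℝ} (hF : IsSupermodular F) (a : α) :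
    IsSupermodular fun S => F (insert a S) := fun S T => by
  simpa only [insert_union_distrib, insert_inter_distrib] using hF (insert a S) (insert a T)

theorem IsSupermodular.discreteDeriv_le_insert {F : Finset α → ℝ} (hF : IsSupermodular F)
    (a e : α) (S : Finset α) :
    discreteDeriv e F S ≤ discreteDeriv e F (insert a S) := by
  have union_eq : insert e S ∪ (insert a S).erase e = insert e (insert a S) := by grind
  have inter_eq : insert e S ∩ (insert a S).erase e = S.erase e := by grind
  have key := hF (insert e S) ((insert a S).erase e)
  rw [union_eq, inter_eq] at key
  simp only [discreteDeriv]
  linarith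

end SetFunction

section BernoulliMean

open Finset

variable {α ι E G : Type*} [AddCommGroup E] [Module ℝ E] [AddCommGroup G]

/-- The mean of `F` over the random subset of `U` which contains every element of `U` independently
with probability `x`. -/
noncomputable def bernoulliMean (U : Finset α) (x : ℝ) (F : Finset α → E) : E :=
  ∑ S ∈ U.powerset, (x ^ #S * (1 - x) ^ (#U - #S)) • F S

theorem bernoulliMean_empty (x : ℝ) (F : Finset α → E) : bernoulliMean ∅ x F = F ∅ := by
  simp [bernoulliMean]

theorem bernoulliMean_congr {U : Finset α} (x : ℝ) {F G : Finset α → E}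
    (h : ∀ S ⊆ U, F S = G S) : bernoulliMean U x F = bernoulliMean U x G :=
  sum_congr rfl fun S hS => by rw [h S (mem_powerset.1 hS)]

theorem bernoulliMean_add (U : Finset α) (x : ℝ) (F G : Finset α → E) :
    bernoulliMean U x (fun S => F S + G S) = bernoulliMean U x F + bernoulliMean U x G := by
  simp [bernoulliMean, smul_add, sum_add_distrib]

theorem bernoulliMean_sub (U : Finset α) (x : ℝ) (F G : Finset α → E) :
    bernoulliMean U x (fun S => F S - G S) = bernoulliMean U x F - bernoulliMean U x G := by
  simp [bernoulliMean, smul_sub, sum_sub_distrib]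

theorem bernoulliMean_sum (s : Finset ι) (U : Finset α) (x : ℝ) (F : ι → Finset α → E) :
    bernoulliMean U x (fun S => ∑ i ∈ s, F i S) = ∑ i ∈ s, bernoulliMean U x (F i) := by
  simp only [bernoulliMean, smul_sum]
  exact sum_comm

theorem bernoulliMean_const_mul (U : Finset α) (x c : ℝ) (F : Finset α → ℝ) :
    bernoulliMean U x (fun S => c * F S) = c * bernoulliMean U x F := by
  simp only [bernoulliMean, smul_eq_mul, mul_sum, mul_left_comm]

theorem bernoulliMean_const (U : Finset α) (x : ℝ) (c : E) :
    bernoulliMean U x (fun _ => c) = c := by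
  simp [bernoulliMean, ← sum_smul, sum_pow_mul_eq_add_pow]

theorem bernoulliMean_pow_card (U : Finset α) (x : ℝ) (c : ℂ) :
    bernoulliMean U x (fun S => c ^ #S) = (x * c + (1 - x)) ^ #U := by
  rw [← sum_pow_mul_eq_add_pow, bernoulliMean]
  refine sum_congr rfl fun S _ => ?_
  rw [Complex.real_smul]
  push_cast
  ring

theorem bernoulliMean_mono {U : Finset α} {x : ℝ} (hx0 : 0 ≤ x) (hx1 : x ≤ 1)
    {F G : Finset α → ℝ} (h : ∀ S ⊆ U, F S ≤ G S) : bernoulliMean U x F ≤ bernoulliMean U x G :=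
  sum_le_sum fun S hS => mul_le_mul_of_nonneg_left (h S (mem_powerset.1 hS))
    (mul_nonneg (pow_nonneg hx0 _) (pow_nonneg (sub_nonneg.2 hx1) _))

theorem bernoulliMean_nonneg {U : Finset α} {x : ℝ} (hx0 : 0 ≤ x) (hx1 : x ≤ 1)
    {F : Finset α → ℝ} (h : ∀ S ⊆ U, 0 ≤ F S) : 0 ≤ bernoulliMean U x F := by
  rw [← bernoulliMean_const U x (0 : ℝ)]
  exact bernoulliMean_mono hx0 hx1 h

theorem norm_bernoulliMean_le {U : Finset α} {x : ℝ} (hx0 : 0 ≤ x) (hx1 : x ≤ 1)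
    (F : Finset α → ℂ) : ‖bernoulliMean U x F‖ ≤ bernoulliMean U x (fun S => ‖F S‖) := by
  refine (norm_sum_le _ _).trans (sum_le_sum fun S _ => ?_)
  rw [norm_smul, Real.norm_of_nonneg
    (mul_nonneg (pow_nonneg hx0 _) (pow_nonneg (sub_nonneg.2 hx1) _)), smul_eq_mul]

theorem bernoulliMean_sub_const_sq (U : Finset α) (x c : ℝ) (F : Finset α → ℝ) :
    bernoulliMean U x (fun S => (F S - c) ^ 2) =
      bernoulliMean U x (fun S => F S ^ 2) - 2 * c * bernoulliMean U x F + c ^ 2 := by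
  have expand : ∀ S, (F S - c) ^ 2 = F S ^ 2 - 2 * c * F S + c ^ 2 := fun S => by ring
  simp only [expand, bernoulliMean_add, bernoulliMean_sub, bernoulliMean_const_mul,
    bernoulliMean_const]

theorem bernoulliMean_sub_mean_sq (U : Finset α) (x : ℝ) (F : Finset α → ℝ) :
    bernoulliMean U x (fun S => (F S - bernoulliMean U x F) ^ 2) =
      bernoulliMean U x (fun S => F S ^ 2) - bernoulliMean U x F ^ 2 := by
  rw [bernoulliMean_sub_const_sq]
  ring

theorem sq_bernoulliMean_le {U : Finset α} {x : ℝ} (hx0 : 0 ≤ x) (hx1 : x ≤ 1)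
    (F : Finset α → ℝ) : bernoulliMean U x F ^ 2 ≤ bernoulliMean U x (fun S => F S ^ 2) := by
  rw [← sub_nonneg, ← bernoulliMean_sub_mean_sq]
  exact bernoulliMean_nonneg hx0 hx1 fun S _ => sq_nonneg _

variable [DecidableEq α]

theorem bernoulliMean_insert {U : Finset α} {a : α} (ha : a ∉ U) (x : ℝ) (F : Finset α → E) :
    bernoulliMean (insert a U) x F =
      x • bernoulliMean U x (fun S => F (insert a S)) + (1 - x) • bernoulliMean U x F := by
  unfold bernoulliMean
  rw [sum_powerset_insert ha, add_comm, smul_sum, smul_sum, card_insert_of_notMem ha]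
  congr 1
  · refine sum_congr rfl fun S hS => ?_
    have haS : a ∉ S := fun h => ha (mem_powerset.1 hS h)
    rw [card_insert_of_notMem haS, smul_smul, Nat.add_sub_add_right, pow_succ]
    ring_nf
  · refine sum_congr rfl fun S hS => ?_
    rw [smul_smul, Nat.sub_add_comm (card_le_card (mem_powerset.1 hS)), pow_succ]
    ring_nf

theorem bernoulliMean_insert_discreteDeriv {U : Finset α} {a : α} (ha : a ∉ U) (x : ℝ)
    (φ : G → E) (F : Finset α → G) :
    bernoulliMean (insert a U) x (fun S => φ (discreteDeriv a F S)) =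
      bernoulliMean U x (fun S => φ (F (insert a S) - F S)) := by
  have deriv_eq : ∀ S ⊆ U, discreteDeriv a F S = F (insert a S) - F S := fun S hS => by
    rw [discreteDeriv, erase_eq_of_notMem fun h => ha (hS h)]
  have deriv_insert_eq : ∀ S ⊆ U, discreteDeriv a F (insert a S) = F (insert a S) - F S :=
    fun S hS => by rw [discreteDeriv, insert_idem, erase_insert fun h => ha (hS h)]
  rw [bernoulliMean_insert ha,
    bernoulliMean_congr x fun S hS => congrArg φ (deriv_insert_eq S hS),
    bernoulliMean_congr x fun S hS => congrArg φ (deriv_eq S hS), ← add_smul,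
    add_sub_cancel, one_smul]

theorem sum_bernoulliMean_insert_discreteDeriv {U : Finset α} {a : α} (ha : a ∉ U) (x : ℝ)
    (φ : G → E) (F : Finset α → G) :
    ∑ e ∈ insert a U, bernoulliMean (insert a U) x (fun S => φ (discreteDeriv e F S)) =
      bernoulliMean U x (fun S => φ (F (insert a S) - F S)) +
        (x • ∑ e ∈ U, bernoulliMean U x
            (fun S => φ (discreteDeriv e (fun T => F (insert a T)) S)) +
          (1 - x) • ∑ e ∈ U, bernoulliMean U x (fun S => φ (discreteDeriv e F S))) := by
  rw [sum_insert ha, bernoulliMean_insert_discreteDeriv ha, smul_sum, smul_sum, ← sum_add_distrib]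
  congr 1
  refine sum_congr rfl fun e he => ?_
  rw [bernoulliMean_insert ha]
  simp only [discreteDeriv_comp_insert (ne_of_mem_of_not_mem he ha).symm]

/-- The **Efron–Stein inequality** for functions of independent Bernoulli variables. -/
theorem bernoulliMean_sq_sub_sq_bernoulliMean_le {x : ℝ} (hx0 : 0 ≤ x) (hx1 : x ≤ 1)
    (U : Finset α) (F : Finset α → ℝ) :
    bernoulliMean U x (fun S => F S ^ 2) - bernoulliMean U x F ^ 2 ≤
      x * (1 - x) * ∑ e ∈ U, bernoulliMean U x (fun S => discreteDeriv e F S ^ 2) := by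
  induction U using Finset.induction_on generalizing F with
  | empty => simp [bernoulliMean_empty]
  | insert a U ha ih =>
    have on_insert := mul_le_mul_of_nonneg_left (ih fun S => F (insert a S)) hx0
    have off_insert := mul_le_mul_of_nonneg_left (ih F) (sub_nonneg.2 hx1)
    have sq_mean_deriv_le := mul_le_mul_of_nonneg_left
      (sq_bernoulliMean_le (U := U) hx0 hx1 fun S => F (insert a S) - F S)
      (mul_nonneg hx0 (sub_nonneg.2 hx1))
    rw [bernoulliMean_sub] at sq_mean_deriv_le
    rw [sum_bernoulliMean_insert_discreteDeriv ha x (· ^ 2), bernoulliMean_insert ha,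
      bernoulliMean_insert ha]
    simp only [smul_eq_mul]
    linear_combination on_insert + off_insert + sq_mean_deriv_le

-- The mean is a convex function of `x`, and its derivative is the sum on the right-hand side.
theorem IsSupermodular.bernoulliMean_sub_le {F : Finset α → ℝ} (hF : IsSupermodular F) {x t : ℝ}
    (ht0 : 0 ≤ t) (htx : t ≤ x) (hx1 : x ≤ 1) (U : Finset α) :
    bernoulliMean U x F - bernoulliMean U t F ≤
      (x - t) * ∑ e ∈ U, bernoulliMean U x (discreteDeriv e F) := by
  have hx0 := ht0.trans htx
  induction U using Finset.induction_on generalizing F with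
  | empty => simp [bernoulliMean_empty]
  | insert a U ha ih =>
    have on_insert := mul_le_mul_of_nonneg_left (ih (hF.comp_insert a)) ht0
    have off_insert := mul_le_mul_of_nonneg_left (ih hF) (sub_nonneg.2 (htx.trans hx1))
    have sum_deriv_le : ∑ e ∈ U, bernoulliMean U x (discreteDeriv e F) ≤
        ∑ e ∈ U, bernoulliMean U x (discreteDeriv e fun T => F (insert a T)) := by
      refine sum_le_sum fun e he => bernoulliMean_mono hx0 hx1 fun S _ => ?_
      have hae : a ≠ e := (ne_of_mem_of_not_mem he ha).symm
      rw [discreteDeriv_comp_insert hae]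
      exact hF.discreteDeriv_le_insert a e S
    have gain := mul_le_mul_of_nonneg_left sum_deriv_le (sq_nonneg (x - t))
    have split := sum_bernoulliMean_insert_discreteDeriv ha x id F
    simp only [id, bernoulliMean_sub, smul_eq_mul] at split
    rw [split, bernoulliMean_insert ha, bernoulliMean_insert ha]
    simp only [smul_eq_mul]
    linear_combination on_insert + off_insert + gain

end BernoulliMean

section SubsetCount

open Finset

variable {α ι : Type*} [DecidableEq α]

theorem bernoulliMean_subset_indicator {U T : Finset α} (hT : T ⊆ U) (x : ℝ) :
    bernoulliMean U x (fun S => if T ⊆ S then (1 : ℝ) else 0) = x ^ #T := by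
  induction U using Finset.induction_on generalizing T with
  | empty => simp [bernoulliMean_empty, subset_empty.1 hT]
  | insert a U ha ih =>
    simp only [bernoulliMean_insert ha, subset_insert_iff]
    rw [ih (by rwa [← subset_insert_iff])]
    by_cases haT : a ∈ T
    · have never_subset : bernoulliMean U x (fun S => if T ⊆ S then (1 : ℝ) else 0) = 0 :=
        (bernoulliMean_congr _ fun S hS => if_neg fun h => ha (hS (h haT))).trans
          (bernoulliMean_const U x 0)
      rw [never_subset, ← card_erase_add_one haT, pow_succ', smul_zero, add_zero, smul_eq_mul]
    · rw [erase_eq_of_notMem haT, ih ((subset_insert_iff_of_notMem haT).1 hT), ← add_smul,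
        add_sub_cancel, one_smul]

/-- The number of members of the family `T`, indexed by `s`, which are contained in `S`. -/
def subsetCount (s : Finset ι) (T : ι → Finset α) (S : Finset α) : ℝ :=
  ∑ a ∈ s, if T a ⊆ S then 1 else 0

variable {U : Finset α} {s : Finset ι} {T : ι → Finset α}

theorem discreteDeriv_subsetCount (e : α) (s : Finset ι) (T : ι → Finset α) :
    discreteDeriv e (subsetCount s T) = subsetCount {a ∈ s | e ∈ T a} (fun a => (T a).erase e) := by
  funext S
  rw [discreteDeriv, subsetCount, subsetCount, ← sum_sub_distrib, subsetCount, sum_filter]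
  refine sum_congr rfl fun a _ => ?_
  by_cases he : e ∈ T a
  · have not_subset : ¬T a ⊆ S.erase e := fun h => notMem_erase e S (h he)
    simp [he, not_subset, subset_insert_iff]
  · have subset_iff : T a ⊆ S.erase e ↔ T a ⊆ S := by rw [subset_erase, and_iff_left he]
    simp [he, subset_iff, subset_insert_iff_of_notMem he]

theorem bernoulliMean_subsetCount (hT : ∀ a ∈ s, T a ⊆ U) (x : ℝ) :
    bernoulliMean U x (subsetCount s T) = ∑ a ∈ s, x ^ #(T a) := by
  exact (bernoulliMean_sum s U x _).trans <|
    sum_congr rfl fun a ha => bernoulliMean_subset_indicator (hT a ha) x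

theorem bernoulliMean_subsetCount_sq (hT : ∀ a ∈ s, T a ⊆ U) (x : ℝ) :
    bernoulliMean U x (fun S => subsetCount s T S ^ 2) =
      ∑ q ∈ s ×ˢ s, x ^ #(T q.1 ∪ T q.2) := by
  have sq_eq : ∀ S, subsetCount s T S ^ 2 =
      ∑ q ∈ s ×ˢ s, if T q.1 ∪ T q.2 ⊆ S then (1 : ℝ) else 0 := fun S => by
    simp only [subsetCount, sq, sum_mul_sum, ← sum_product', union_subset_iff, ite_and, mul_ite,
      mul_one, mul_zero]
    exact sum_congr rfl fun q _ => by split_ifs <;> rfl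
  simp only [sq_eq, bernoulliMean_sum]
  refine sum_congr rfl fun q hq => bernoulliMean_subset_indicator ?_ x
  exact union_subset (hT _ (mem_product.1 hq).1) (hT _ (mem_product.1 hq).2)

theorem bernoulliMean_subsetCount_sub_mean_sq_le (hT : ∀ a ∈ s, T a ⊆ U) {x : ℝ} (hx0 : 0 ≤ x) :
    bernoulliMean U x (fun S => (subsetCount s T S - bernoulliMean U x (subsetCount s T)) ^ 2) ≤
      ∑ q ∈ s ×ˢ s with ¬Disjoint (T q.1) (T q.2), x ^ #(T q.1 ∪ T q.2) := by
  have disjoint_le : ∑ q ∈ s ×ˢ s with Disjoint (T q.1) (T q.2), x ^ #(T q.1 ∪ T q.2) ≤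
      bernoulliMean U x (subsetCount s T) ^ 2 := by
    rw [bernoulliMean_subsetCount hT, sq, sum_mul_sum, ← sum_product']
    refine (sum_le_sum fun q hq => ?_).trans
      (sum_le_sum_of_subset_of_nonneg (filter_subset _ _) fun q _ _ => by positivity)
    rw [card_union_of_disjoint (mem_filter.1 hq).2, pow_add]
  rw [bernoulliMean_sub_mean_sq, bernoulliMean_subsetCount_sq hT,
    ← sum_filter_add_sum_filter_not (s ×ˢ s) fun q => Disjoint (T q.1) (T q.2)]
  linarith

end SubsetCount

section BernoulliCard

open Finset

variable {α : Type*}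

theorem bernoulliMean_card_sub_sq (U : Finset α) (x c : ℝ) :
    bernoulliMean U x (fun S => ((#S : ℝ) - c) ^ 2) = #U * x * (1 - x) + (#U * x - c) ^ 2 := by
  classical
  induction U using Finset.induction_on generalizing c with
  | empty => simp [bernoulliMean_empty]
  | insert a U ha ih =>
    have shift : ∀ S ⊆ U, ((#(insert a S) : ℝ) - c) ^ 2 = ((#S : ℝ) - (c - 1)) ^ 2 :=
      fun S hS => by
        rw [card_insert_of_notMem fun h => ha (hS h)]
        push_cast; ring
    rw [bernoulliMean_insert ha, bernoulliMean_congr x shift, ih, ih, card_insert_of_notMem ha]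
    simp only [smul_eq_mul]
    push_cast
    ring

theorem bernoulliMean_card (U : Finset α) (x : ℝ) :
    bernoulliMean U x (fun S => (#S : ℝ)) = #U * x := by
  classical
  have card_eq : ∀ S ⊆ U, (#S : ℝ) = subsetCount U singleton S := fun S hS => by
    simp [subsetCount, inter_eq_right.2 hS]
  rw [bernoulliMean_congr x card_eq]
  simp [bernoulliMean_subsetCount fun _ => singleton_subset_iff.2]

end BernoulliCard

section Finrank

open Module

variable {K M N α : Type*} [Field K] [AddCommGroup M] [Module K M] [AddCommGroup N] [Module K N]

theorem finrank_inf_ker_add_finrank_map [FiniteDimensional K M] (p : Submodule K M)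
    (f : M →ₗ[K] N) :
    finrank K (p ⊓ LinearMap.ker f : Submodule K M) + finrank K (p.map f) = finrank K p := by
  have range_eq : LinearMap.range (f.domRestrict p) = p.map f := by
    rw [LinearMap.domRestrict, LinearMap.range_comp, Submodule.range_subtype]
  have map_ker_eq : (LinearMap.ker (f.domRestrict p)).map p.subtype = p ⊓ LinearMap.ker f := by
    rw [LinearMap.domRestrict, LinearMap.ker_comp, Submodule.map_comap_subtype]
  rw [← map_ker_eq, ← range_eq,
    ← (Submodule.equivMapOfInjective _ p.injective_subtype _).finrank_eq, add_comm]
  exact (f.domRestrict p).finrank_range_add_finrank_ker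

theorem finrank_supported (s : Set α) : finrank K (Finsupp.supported K K s) = s.ncard := by
  rw [(Finsupp.supportedEquivFinsupp s).finrank_eq, finrank, rank_finsupp_self,
    Cardinal.toNat_lift, ← Nat.card, Nat.card_coe_set_eq]

end Finrank

section CliqueChains

open Module SimpleGraph AbstractSimplicialComplex

variable {V : Type*}

/-- The inclusion of the chains of a complex into the formal combinations of all vertex sets. -/
noncomputable def chainInclusion (K : AbstractSimplicialComplex V) (k : ℕ) :
    K.Chain k →ₗ[ℚ] (Finset V →₀ ℚ) :=
  Finsupp.lmapDomain ℚ ℚ Subtype.val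

theorem chainInclusion_injective (K : AbstractSimplicialComplex V) (k : ℕ) :
    Function.Injective (chainInclusion K k) :=
  Finsupp.mapDomain_injective Subtype.val_injective

theorem finrank_map_chainInclusion (K : AbstractSimplicialComplex V) (k : ℕ)
    (p : Submodule ℚ (K.Chain k)) : finrank ℚ (p.map (chainInclusion K k)) = finrank ℚ p :=
  (Submodule.equivMapOfInjective _ (chainInclusion_injective K k) p).finrank_eq.symm

theorem range_chainInclusion_cliqueComplex (G : SimpleGraph V) (k : ℕ) :
    LinearMap.range (chainInclusion G.cliqueComplex k) =
      Finsupp.supported ℚ ℚ (G.cliqueSet (k + 1)) := by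
  have cliqueSet_eq : G.cliqueSet (k + 1) =
      Set.range (Subtype.val : G.cliqueComplex.Face k → Finset V) := by
    ext s
    simp only [mem_cliqueSet_iff, isNClique_iff, Subtype.range_coe_subtype, Set.mem_ofPred_eq]
    exact ⟨fun ⟨h, hs⟩ => ⟨⟨Finset.card_pos.1 (by omega), h⟩, hs⟩, fun ⟨h, hs⟩ => ⟨h.2, hs⟩⟩
  rw [cliqueSet_eq, chainInclusion, Finsupp.range_lmapDomain, Finsupp.supported_eq_span_single,
    ← Set.range_comp]
  rfl

variable [LinearOrder V]

/-- The simplicial boundary operator on formal combinations of arbitrary finite vertex sets. It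
puts the boundary operators of all complexes on `V` into one ambient space. -/
noncomputable def simplexBoundary (V : Type*) [LinearOrder V] :
    (Finset V →₀ ℚ) →ₗ[ℚ] (Finset V →₀ ℚ) :=
  Finsupp.linearCombination ℚ fun s : Finset V =>
    ∑ v : s, Finsupp.single (s.erase v.1) (vertexSign s v.1)

theorem simplexBoundary_comp_chainInclusion (K : AbstractSimplicialComplex V) (k : ℕ) :
    simplexBoundary V ∘ₗ chainInclusion K (k + 1) = chainInclusion K k ∘ₗ K.boundary k := by
  ext1 s
  ext1
  simp [simplexBoundary, chainInclusion, boundary, Finsupp.mapDomain_single, Face.facet]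

theorem map_simplexBoundary_supported_cliqueSet (k : ℕ) (G : SimpleGraph V) :
    (Finsupp.supported ℚ ℚ (G.cliqueSet (k + 2))).map (simplexBoundary V) =
      (G.cliqueComplex.boundaries k).map (chainInclusion G.cliqueComplex k) := by
  rw [← range_chainInclusion_cliqueComplex, ← LinearMap.range_comp,
    simplexBoundary_comp_chainInclusion, LinearMap.range_comp, boundaries]

theorem map_chainInclusion_cycles (k : ℕ) (G : SimpleGraph V) :
    (G.cliqueComplex.cycles (k + 1)).map (chainInclusion G.cliqueComplex (k + 1)) =
      Finsupp.supported ℚ ℚ (G.cliqueSet (k + 2)) ⊓ LinearMap.ker (simplexBoundary V) := by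
  rw [← range_chainInclusion_cliqueComplex, ← Submodule.map_comap_eq, ← LinearMap.ker_comp,
    simplexBoundary_comp_chainInclusion, LinearMap.ker_comp_of_ker_eq_bot _
    (LinearMap.ker_eq_bot.2 (chainInclusion_injective _ _)), cycles]

/-- The number of cliques on `k + 1` vertices, i.e. of `k`-dimensional faces of the clique
complex. -/
noncomputable def cliqueCount (k : ℕ) (G : SimpleGraph V) : ℕ := (G.cliqueSet (k + 1)).ncard

/-- The dimension of the space of `k`-cycles of the clique complex, where a `0`-chain is a cycle
only if its augmentation vanishes. -/
noncomputable def cliqueNullity (k : ℕ) (G : SimpleGraph V) : ℕ :=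
  finrank ℚ (Finsupp.supported ℚ ℚ (G.cliqueSet (k + 1)) ⊓
    LinearMap.ker (simplexBoundary V) : Submodule ℚ (Finset V →₀ ℚ))

/-- The rank of the boundary operator on the `k`-chains of the clique complex, where for `k = 0`
this operator is the augmentation. -/
noncomputable def cliqueRank (k : ℕ) (G : SimpleGraph V) : ℕ :=
  finrank ℚ ((Finsupp.supported ℚ ℚ (G.cliqueSet (k + 1))).map (simplexBoundary V))

theorem finrank_boundaries_cliqueComplex (k : ℕ) (G : SimpleGraph V) :
    finrank ℚ (G.cliqueComplex.boundaries k) = cliqueRank (k + 1) G := by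
  rw [cliqueRank, map_simplexBoundary_supported_cliqueSet, finrank_map_chainInclusion]

theorem finrank_cycles_cliqueComplex (k : ℕ) (G : SimpleGraph V) :
    finrank ℚ (G.cliqueComplex.cycles (k + 1)) = cliqueNullity (k + 1) G := by
  rw [cliqueNullity, ← map_chainInclusion_cycles, finrank_map_chainInclusion]

variable [Finite V]

theorem betti_cliqueComplex_add_cliqueRank (k : ℕ) (G : SimpleGraph V) :
    G.cliqueComplex.betti (k + 1) + cliqueRank (k + 2) G = cliqueNullity (k + 1) G := by
  rw [← finrank_boundaries_cliqueComplex, ← finrank_cycles_cliqueComplex,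
    ← (Submodule.submoduleOfEquivOfLe (G.cliqueComplex.boundaries_le_cycles (k + 1))).finrank_eq]
  exact Submodule.finrank_quotient_add_finrank _

theorem cliqueNullity_add_cliqueRank (k : ℕ) (G : SimpleGraph V) :
    cliqueNullity k G + cliqueRank k G = cliqueCount k G := by
  rw [cliqueNullity, cliqueRank, finrank_inf_ker_add_finrank_map, finrank_supported,
    cliqueCount]

theorem cliqueRank_succ_le (k : ℕ) (G : SimpleGraph V) :
    cliqueRank (k + 1) G ≤ cliqueCount k G := by
  rw [cliqueRank, map_simplexBoundary_supported_cliqueSet, cliqueCount,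
    ← finrank_supported (K := ℚ), ← range_chainInclusion_cliqueComplex]
  exact Submodule.finrank_mono LinearMap.map_le_range

theorem cliqueNullity_mono (k : ℕ) : Monotone (cliqueNullity (V := V) k) := fun _ _ h =>
  Submodule.finrank_mono (inf_le_inf_right _ (Finsupp.supported_mono (cliqueSet_mono h)))

theorem cliqueRank_mono (k : ℕ) : Monotone (cliqueRank (V := V) k) := fun _ _ h =>
  Submodule.finrank_mono (Submodule.map_mono (Finsupp.supported_mono (cliqueSet_mono h)))

-- Cycle spaces satisfy `Z(G ⊓ H) = Z(G) ⊓ Z(H)` and `Z(G) ⊔ Z(H) ≤ Z(G ⊔ H)`.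
theorem cliqueNullity_add_cliqueNullity_le (k : ℕ) (G H : SimpleGraph V) :
    cliqueNullity k G + cliqueNullity k H ≤ cliqueNullity k (G ⊔ H) + cliqueNullity k (G ⊓ H) := by
  have cliqueSet_inf : (G ⊓ H).cliqueSet (k + 1) = G.cliqueSet (k + 1) ∩ H.cliqueSet (k + 1) := by
    ext s
    simp only [mem_cliqueSet_iff, isNClique_iff, Set.mem_inter_iff, IsClique, Set.Pairwise, inf_adj]
    grind
  unfold cliqueNullity
  rw [← Submodule.finrank_sup_add_finrank_inf_eq, cliqueSet_inf, Finsupp.supported_inter,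
    ← inf_inf_distrib_right]
  refine Nat.add_le_add_right (Submodule.finrank_mono (sup_le ?_ ?_)) _
  · exact inf_le_inf_right _ (Finsupp.supported_mono (cliqueSet_mono le_sup_left))
  · exact inf_le_inf_right _ (Finsupp.supported_mono (cliqueSet_mono le_sup_right))

end CliqueChains

section EdgesOn

open Finset

variable {V : Type*} [DecidableEq V]

/-- The edges of the complete graph on a finite set of vertices. -/
def edgesOn (A : Finset V) : Finset (Sym2 V) := {e ∈ A.sym2 | ¬e.IsDiag}

theorem mem_edgesOn {A : Finset V} {e : Sym2 V} :
    e ∈ edgesOn A ↔ (∀ v ∈ e, v ∈ A) ∧ ¬e.IsDiag := by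
  simp [edgesOn, mem_sym2_iff]

theorem mk_mem_edgesOn {A : Finset V} {a b : V} :
    s(a, b) ∈ edgesOn A ↔ {a, b} ⊆ A ∧ a ≠ b := by
  simp [mem_edgesOn, insert_subset_iff]

theorem card_edgesOn (A : Finset V) : #(edgesOn A) = (#A).choose 2 := by
  rw [← Sym2.card_image_offDiag]
  congr 1
  ext e
  induction e with
  | h a b => simp [mem_edgesOn, Sym2.mk]; grind

theorem edgesOn_inter (A B : Finset V) : edgesOn (A ∩ B) = edgesOn A ∩ edgesOn B := by
  ext e
  simp only [mem_edgesOn, mem_inter]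
  grind

theorem edgesOn_mono : Monotone (edgesOn : Finset V → Finset (Sym2 V)) := fun A B hAB => by
  rw [← inter_eq_left, ← edgesOn_inter, inter_eq_left.2 hAB]

theorem card_union_erase_edgesOn {A B : Finset V} {i : ℕ} (hA : #A = i) (hB : #B = i) {e : Sym2 V}
    (heA : e ∈ edgesOn A) :
    #((edgesOn A).erase e ∪ (edgesOn B).erase e) = 2 * i.choose 2 - 1 - (#(A ∩ B)).choose 2 := by
  have card_union_add := card_union_add_card_inter (edgesOn A) (edgesOn B)
  rw [← edgesOn_inter, card_edgesOn, card_edgesOn, card_edgesOn, hA, hB] at card_union_add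
  rw [← erase_union_distrib, card_erase_of_mem (mem_union_left _ heA)]
  omega

theorem two_le_card_of_mem_edgesOn {A : Finset V} {e : Sym2 V} (he : e ∈ edgesOn A) : 2 ≤ #A := by
  by_contra! hlt
  simpa [card_edgesOn, Nat.choose_eq_zero_of_lt hlt] using card_pos.2 ⟨e, he⟩

theorem disjoint_erase_edgesOn {A B : Finset V} {e : Sym2 V} (heA : e ∈ edgesOn A)
    (heB : e ∈ edgesOn B) (hAB : #(A ∩ B) = 2) :
    Disjoint ((edgesOn A).erase e) ((edgesOn B).erase e) := by
  have he : e ∈ edgesOn (A ∩ B) := edgesOn_inter A B ▸ mem_inter.2 ⟨heA, heB⟩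
  have inter_eq : (edgesOn A).erase e ∩ (edgesOn B).erase e = (edgesOn (A ∩ B)).erase e := by
    rw [edgesOn_inter]; grind
  rw [disjoint_iff_inter_eq_empty, inter_eq, ← card_eq_zero, card_erase_of_mem he, card_edgesOn,
    hAB, Nat.choose_self]

variable [Fintype V]

theorem card_filter_card_inter_le {i l : ℕ} {A : Finset V} (hA : #A = i) :
    #{B ∈ powersetCard i univ | #(A ∩ B) = l} ≤ 2 ^ i * Fintype.card V ^ (i - l) := by
  have maps_to : Set.MapsTo (fun B => (A ∩ B, B \ A))
      ({B ∈ powersetCard i univ | #(A ∩ B) = l} : Finset (Finset V))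
      (A.powerset ×ˢ powersetCard (i - l) univ : Finset (Finset V × Finset V)) := fun B hB => by
    obtain ⟨hcard, hinter⟩ := mem_filter.1 (mem_coe.1 hB)
    rw [mem_powersetCard_univ] at hcard
    rw [mem_coe, mem_product, mem_powerset, mem_powersetCard_univ, card_sdiff, hcard, hinter]
    exact ⟨inter_subset_left, rfl⟩
  have inj_on : Set.InjOn (fun B => (A ∩ B, B \ A))
      ({B ∈ powersetCard i univ | #(A ∩ B) = l} : Finset (Finset V)) := fun B _ C _ h => by
    obtain ⟨hinter, hsdiff⟩ := Prod.mk.inj h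
    rw [← sdiff_union_inter B A, ← sdiff_union_inter C A, hsdiff, inter_comm B, inter_comm C,
      hinter]
  calc #{B ∈ powersetCard i univ | #(A ∩ B) = l}
      ≤ #(A.powerset ×ˢ powersetCard (i - l) (univ : Finset V)) :=
        card_le_card_of_injOn _ maps_to inj_on
    _ ≤ 2 ^ i * Fintype.card V ^ (i - l) := by
        rw [card_product, card_powerset, hA, card_powersetCard, card_univ]
        exact Nat.mul_le_mul_left _ (Nat.choose_le_pow _ _)

/-- The sets of `i` vertices which contain both ends of the edge `e`. -/
def supersets (i : ℕ) (e : Sym2 V) : Finset (Finset V) := {A ∈ powersetCard i univ | e ∈ edgesOn A}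

theorem mem_supersets {i : ℕ} {e : Sym2 V} {A : Finset V} :
    A ∈ supersets i e ↔ #A = i ∧ e ∈ edgesOn A := by
  simp [supersets]

theorem card_supersets (i : ℕ) {e : Sym2 V} (he : ¬e.IsDiag) :
    #(supersets (i + 2) e) = (Fintype.card V - 2).choose i := by
  induction e with
  | h a b =>
    have hab : a ≠ b := by simpa using he
    have card_eq := card_filter_powersetCard_subset {a, b} univ (i + 2) (subset_univ _)
      (by rw [card_pair hab]; omega)
    simpa [supersets, mk_mem_edgesOn, hab] using card_eq

theorem card_supersets_pairs_le (i l : ℕ) {e : Sym2 V} (he : ¬e.IsDiag) (hl : l ≤ i) :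
    #{q ∈ supersets (i + 2) e ×ˢ supersets (i + 2) e | #(q.1 ∩ q.2) = l + 2} ≤
      2 ^ (i + 2) * Fintype.card V ^ (2 * i - l) := by
  have card_le : #(supersets (i + 2) e) ≤ Fintype.card V ^ i := by
    rw [card_supersets i he]
    exact (Nat.choose_le_pow _ _).trans (Nat.pow_le_pow_left (Nat.sub_le _ _) _)
  have card_fiber_le : ∀ A ∈ supersets (i + 2) e,
      #{B ∈ supersets (i + 2) e | #(A ∩ B) = l + 2} ≤
        2 ^ (i + 2) * Fintype.card V ^ (i - l) := fun A hA => by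
    rw [← Nat.add_sub_add_right i 2 l]
    exact (card_le_card (filter_subset_filter _ (filter_subset _ _))).trans
      (card_filter_card_inter_le (mem_supersets.1 hA).1)
  calc #{q ∈ supersets (i + 2) e ×ˢ supersets (i + 2) e | #(q.1 ∩ q.2) = l + 2}
      = ∑ A ∈ supersets (i + 2) e, #{B ∈ supersets (i + 2) e | #(A ∩ B) = l + 2} := by
        simp only [card_filter, sum_product]
    _ ≤ #(supersets (i + 2) e) * (2 ^ (i + 2) * Fintype.card V ^ (i - l)) :=
        sum_le_card_nsmul _ _ _ card_fiber_le
    _ ≤ Fintype.card V ^ i * (2 ^ (i + 2) * Fintype.card V ^ (i - l)) :=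
        Nat.mul_le_mul_right _ card_le
    _ = 2 ^ (i + 2) * Fintype.card V ^ (2 * i - l) := by
        rw [show 2 * i - l = i + (i - l) by omega, pow_add]
        ring

end EdgesOn

section ExtensionScale

/-- The order of magnitude of the number of cliques on `i + 2` vertices through a given edge in the
binomial random graph on `n` vertices with edge probability `x`. -/
noncomputable def extensionScale (n : ℕ) (x : ℝ) (i : ℕ) : ℝ := n ^ i * x ^ ((i + 2).choose 2 - 1)

variable {n i l : ℕ} {x : ℝ}

theorem extensionScale_zero (n : ℕ) (x : ℝ) : extensionScale n x 0 = 1 := by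
  simp [extensionScale]

theorem extensionScale_succ (n : ℕ) (x : ℝ) (i : ℕ) :
    extensionScale n x (i + 1) = extensionScale n x i * (n * x ^ (i + 2)) := by
  have choose_pos : 0 < (i + 2).choose 2 := Nat.choose_pos (by omega)
  have exponent_eq : (i + 1 + 2).choose 2 - 1 = (i + 2).choose 2 - 1 + (i + 2) := by
    have pascal : (i + 1 + 2).choose 2 = i + 2 + (i + 2).choose 2 := by
      rw [Nat.choose_succ_succ' (i + 2) 1, Nat.choose_one_right]
    omega
  rw [extensionScale, extensionScale, exponent_eq, pow_succ, pow_add]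
  ring

theorem extensionScale_pos (hn : 0 < n) (hx : 0 < x) (i : ℕ) : 0 < extensionScale n x i := by
  unfold extensionScale
  positivity

theorem one_le_extensionScale (hx0 : 0 ≤ x) (hx1 : x ≤ 1) (hw : 1 ≤ n * x ^ (i + 1))
    (hl : l ≤ i) : 1 ≤ extensionScale n x l := by
  induction l with
  | zero => rw [extensionScale_zero]
  | succ l ih =>
    rw [extensionScale_succ]
    refine one_le_mul_of_one_le_of_one_le (ih (by omega)) (hw.trans ?_)
    exact mul_le_mul_of_nonneg_left (pow_le_pow_of_le_one hx0 hx1 (by omega)) n.cast_nonneg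

theorem le_extensionScale (hx0 : 0 ≤ x) (hx1 : x ≤ 1) (hw : 1 ≤ n * x ^ (i + 1))
    (hl1 : 1 ≤ l) (hl : l ≤ i) : n * x ^ (i + 1) ≤ extensionScale n x l := by
  obtain ⟨l, rfl⟩ := Nat.exists_eq_add_of_le' hl1
  rw [extensionScale_succ, ← one_mul ((n : ℝ) * x ^ (i + 1))]
  exact mul_le_mul (one_le_extensionScale hx0 hx1 hw (by omega))
    (mul_le_mul_of_nonneg_left (pow_le_pow_of_le_one hx0 hx1 (by omega)) n.cast_nonneg)
    (by positivity) (zero_le_one.trans (one_le_extensionScale hx0 hx1 hw (by omega)))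

theorem pow_mul_pow_eq_extensionScale_sq_div (hn : 0 < n) (hx : 0 < x) (hl : l ≤ i) :
    (n : ℝ) ^ (2 * i - l) * x ^ (2 * (i + 2).choose 2 - 1 - (l + 2).choose 2) =
      extensionScale n x i ^ 2 / extensionScale n x l := by
  have choose_pos : 0 < (l + 2).choose 2 := Nat.choose_pos (by omega)
  have choose_le : (l + 2).choose 2 ≤ (i + 2).choose 2 := Nat.choose_le_choose 2 (by omega)
  rw [eq_div_iff (extensionScale_pos hn hx l).ne', extensionScale, extensionScale, mul_mul_mul_comm,
    ← pow_add, ← pow_add, mul_pow, ← pow_mul, ← pow_mul]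
  congr 2 <;> omega

/-- The expected number of cliques on `i + 2` vertices created by adding a fixed edge to the
binomial random graph on `n` vertices with edge probability `x`. -/
noncomputable def meanInfluence (n i : ℕ) (x : ℝ) : ℝ :=
  (n - 2).choose i * x ^ ((i + 2).choose 2 - 1)

theorem choose_two_mul_meanInfluence (n i : ℕ) (x : ℝ) :
    n.choose 2 * meanInfluence n i x * x =
      (i + 2).choose 2 * (n.choose (i + 2) * x ^ (i + 2).choose 2) := by
  have choose_mul : (n.choose (i + 2) : ℝ) * (i + 2).choose 2 = n.choose 2 * (n - 2).choose i := by
    exact_mod_cast Nat.choose_mul (n := n) (k := i + 2) (s := 2) (by omega)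
  have choose_pos : 0 < (i + 2).choose 2 := Nat.choose_pos (by omega)
  rw [meanInfluence, ← pow_sub_one_mul choose_pos.ne' x]
  linear_combination (-(x ^ ((i + 2).choose 2 - 1) * x)) * choose_mul

end ExtensionScale

section CliqueInfluence

open Finset SimpleGraph

variable {V : Type*}

/-- A graph parameter, seen as a real function of the set of edges. -/
def onEdges (f : SimpleGraph V → ℕ) (S : Finset (Sym2 V)) : ℝ :=
  f (fromEdgeSet (S : Set (Sym2 V)))

theorem onEdges_mono {f : SimpleGraph V → ℕ} (hf : Monotone f) : Monotone (onEdges f) :=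
  fun _ _ hST => Nat.cast_le.2 (hf (fromEdgeSet_mono (coe_subset.2 hST)))

variable [DecidableEq V]

theorem isClique_fromEdgeSet_iff {S : Finset (Sym2 V)} {A : Finset V} :
    (fromEdgeSet (S : Set (Sym2 V))).IsClique A ↔ edgesOn A ⊆ S := by
  constructor
  · intro hA e he
    induction e with
    | h a b =>
      obtain ⟨hab, hne⟩ := mk_mem_edgesOn.1 he
      rw [insert_subset_iff, singleton_subset_iff] at hab
      exact mem_coe.1 ((fromEdgeSet_adj _).1 (hA hab.1 hab.2 hne)).1
  · intro hAS a ha b hb hne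
    have hab : {a, b} ⊆ A := insert_subset ha (singleton_subset_iff.2 hb)
    exact (fromEdgeSet_adj _).2 ⟨mem_coe.2 (hAS (mk_mem_edgesOn.2 ⟨hab, hne⟩)), hne⟩

variable [Fintype V]

theorem onEdges_cliqueCount (k : ℕ) :
    onEdges (cliqueCount k) = subsetCount (powersetCard (k + 1) (univ : Finset V)) edgesOn := by
  funext S
  have cliqueSet_eq : (fromEdgeSet (S : Set (Sym2 V))).cliqueSet (k + 1) =
      ({A ∈ powersetCard (k + 1) (univ : Finset V) | edgesOn A ⊆ S} : Finset (Finset V)) := by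
    ext A
    simp [mem_cliqueSet_iff, isNClique_iff, isClique_fromEdgeSet_iff, and_comm]
  rw [onEdges, cliqueCount, cliqueSet_eq, Set.ncard_coe_finset, subsetCount, card_filter]
  push_cast
  rfl

theorem discreteDeriv_onEdges_cliqueCount (k : ℕ) (e : Sym2 V) :
    discreteDeriv e (onEdges (cliqueCount k)) =
      subsetCount (supersets (k + 1) e) fun A => (edgesOn A).erase e := by
  rw [onEdges_cliqueCount, discreteDeriv_subsetCount, supersets]

theorem bernoulliMean_cliqueCount (k : ℕ) (x : ℝ) :
    bernoulliMean (edgesOn (univ : Finset V)) x (onEdges (cliqueCount k)) =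
      (Fintype.card V).choose (k + 1) * x ^ (k + 1).choose 2 := by
  rw [onEdges_cliqueCount, bernoulliMean_subsetCount fun A _ => edgesOn_mono (subset_univ A),
    sum_congr rfl fun A hA => by rw [card_edgesOn, mem_powersetCard_univ.1 hA], sum_const,
    card_powersetCard, card_univ, nsmul_eq_mul]

theorem erase_edgesOn_subset_edgesOn_univ (e : Sym2 V) (A : Finset V) :
    (edgesOn A).erase e ⊆ edgesOn univ :=
  (erase_subset _ _).trans (edgesOn_mono (subset_univ A))

theorem bernoulliMean_discreteDeriv_cliqueCount (i : ℕ) (x : ℝ) {e : Sym2 V} (he : ¬e.IsDiag) :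
    bernoulliMean (edgesOn univ) x (discreteDeriv e (onEdges (cliqueCount (i + 1)))) =
      meanInfluence (Fintype.card V) i x := by
  have card_erase_eq : ∀ A ∈ supersets (i + 2) e,
      #((edgesOn A).erase e) = (i + 2).choose 2 - 1 := fun A hA => by
    obtain ⟨hA, heA⟩ := mem_supersets.1 hA
    rw [card_erase_of_mem heA, card_edgesOn, hA]
  rw [discreteDeriv_onEdges_cliqueCount,
    bernoulliMean_subsetCount fun A _ => erase_edgesOn_subset_edgesOn_univ e A,
    sum_congr rfl fun A hA => by rw [card_erase_eq A hA], sum_const, card_supersets i he,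
    nsmul_eq_mul, meanInfluence]

theorem exists_card_inter_eq_add_two {i : ℕ} {e : Sym2 V} {q : Finset V × Finset V}
    (hq : q ∈ supersets (i + 2) e ×ˢ supersets (i + 2) e) : ∃ l ≤ i, #(q.1 ∩ q.2) = l + 2 := by
  obtain ⟨hA, hB⟩ := mem_product.1 hq
  obtain ⟨hA, heA⟩ := mem_supersets.1 hA
  have two_le : 2 ≤ #(q.1 ∩ q.2) := two_le_card_of_mem_edgesOn (e := e) <| by
    rw [edgesOn_inter]
    exact mem_inter.2 ⟨heA, (mem_supersets.1 hB).2⟩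
  have card_le := card_le_card (inter_subset_left (s₁ := q.1) (s₂ := q.2))
  exact ⟨#(q.1 ∩ q.2) - 2, by omega, by omega⟩

theorem sum_pow_card_union_erase_edgesOn_le (i : ℕ) {x : ℝ} (hx : 0 < x) {e : Sym2 V}
    (he : ¬e.IsDiag) {s : Finset (Finset V × Finset V)}
    (hs : s ⊆ supersets (i + 2) e ×ˢ supersets (i + 2) e) {I : Finset ℕ} (hI : ∀ l ∈ I, l ≤ i)
    (hsI : ∀ q ∈ s, ∃ l ∈ I, #(q.1 ∩ q.2) = l + 2) :
    ∑ q ∈ s, x ^ #((edgesOn q.1).erase e ∪ (edgesOn q.2).erase e) ≤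
      2 ^ (i + 2) * ∑ l ∈ I, extensionScale (Fintype.card V) x i ^ 2 /
        extensionScale (Fintype.card V) x l := by
  have card_pos : 0 < Fintype.card V := by
    induction e with
    | h a b => exact Fintype.card_pos_iff.2 ⟨a⟩
  have sub_two_mem : ∀ q ∈ s, #(q.1 ∩ q.2) - 2 ∈ I := fun q hq => by
    obtain ⟨l, hl, hcard⟩ := hsI q hq
    rwa [hcard, Nat.add_sub_cancel]
  have mem_fiber : ∀ l, ∀ q ∈ {q ∈ s | #(q.1 ∩ q.2) - 2 = l},
      q ∈ supersets (i + 2) e ×ˢ supersets (i + 2) e ∧ #(q.1 ∩ q.2) = l + 2 := fun l q hq => by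
    obtain ⟨hq, hl⟩ := mem_filter.1 hq
    obtain ⟨l', -, hcard⟩ := hsI q hq
    exact ⟨hs hq, by omega⟩
  have pow_eq : ∀ l, ∀ q ∈ {q ∈ s | #(q.1 ∩ q.2) - 2 = l},
      x ^ #((edgesOn q.1).erase e ∪ (edgesOn q.2).erase e) =
        x ^ (2 * (i + 2).choose 2 - 1 - (l + 2).choose 2) := fun l q hq => by
    obtain ⟨hq, hl⟩ := mem_fiber l q hq
    obtain ⟨hA, hB⟩ := mem_product.1 hq
    obtain ⟨hA, heA⟩ := mem_supersets.1 hA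
    rw [card_union_erase_edgesOn hA (mem_supersets.1 hB).1 heA, hl]
  rw [← sum_fiberwise_of_maps_to sub_two_mem, mul_sum]
  refine sum_le_sum fun l hl => ?_
  have card_fiber_le : (#{q ∈ s | #(q.1 ∩ q.2) - 2 = l} : ℝ) ≤
      2 ^ (i + 2) * (Fintype.card V : ℝ) ^ (2 * i - l) := by
    exact_mod_cast (card_le_card fun q hq => mem_filter.2 (mem_fiber l q hq)).trans
      (card_supersets_pairs_le i l he (hI l hl))
  rw [sum_congr rfl (pow_eq l), sum_const, nsmul_eq_mul,
    ← pow_mul_pow_eq_extensionScale_sq_div card_pos hx (hI l hl), ← mul_assoc]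
  exact mul_le_mul_of_nonneg_right card_fiber_le (pow_nonneg hx.le _)

theorem bernoulliMean_sq_discreteDeriv_cliqueCount_le (i : ℕ) {x : ℝ} (hx : 0 < x) {e : Sym2 V}
    (he : ¬e.IsDiag) :
    bernoulliMean (edgesOn univ) x
        (fun S => discreteDeriv e (onEdges (cliqueCount (i + 1))) S ^ 2) ≤
      2 ^ (i + 2) * ∑ l ∈ range (i + 1), extensionScale (Fintype.card V) x i ^ 2 /
        extensionScale (Fintype.card V) x l := by
  rw [discreteDeriv_onEdges_cliqueCount,
    bernoulliMean_subsetCount_sq fun A _ => erase_edgesOn_subset_edgesOn_univ e A]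
  refine sum_pow_card_union_erase_edgesOn_le i hx he subset_rfl
    (fun l hl => Nat.lt_succ_iff.1 (mem_range.1 hl)) fun q hq => ?_
  obtain ⟨l, hl, hcard⟩ := exists_card_inter_eq_add_two hq
  exact ⟨l, mem_range.2 (Nat.lt_succ_iff.2 hl), hcard⟩

theorem bernoulliMean_sq_discreteDeriv_cliqueCount_sub_le (i : ℕ) {x : ℝ} (hx : 0 < x)
    {e : Sym2 V} (he : ¬e.IsDiag) :
    bernoulliMean (edgesOn univ) x (fun S => (discreteDeriv e (onEdges (cliqueCount (i + 1))) S -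
        meanInfluence (Fintype.card V) i x) ^ 2) ≤
      2 ^ (i + 2) * ∑ l ∈ Icc 1 i, extensionScale (Fintype.card V) x i ^ 2 /
        extensionScale (Fintype.card V) x l := by
  rw [← bernoulliMean_discreteDeriv_cliqueCount i x he, discreteDeriv_onEdges_cliqueCount]
  refine (bernoulliMean_subsetCount_sub_mean_sq_le
    (fun A _ => erase_edgesOn_subset_edgesOn_univ e A) hx.le).trans ?_
  refine sum_pow_card_union_erase_edgesOn_le i hx he (filter_subset _ _)
    (fun l hl => (mem_Icc.1 hl).2) fun q hq => ?_
  obtain ⟨hq, not_disjoint⟩ := mem_filter.1 hq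
  obtain ⟨l, hl, hcard⟩ := exists_card_inter_eq_add_two hq
  obtain ⟨hA, hB⟩ := mem_product.1 hq
  refine ⟨l, mem_Icc.2 ⟨Nat.one_le_iff_ne_zero.2 ?_, hl⟩, hcard⟩
  rintro rfl
  exact not_disjoint (disjoint_erase_edgesOn (mem_supersets.1 hA).2 (mem_supersets.1 hB).2 hcard)

theorem bernoulliMean_sq_discreteDeriv_cliqueCount_sub_le_div {i : ℕ} {x : ℝ} (hx0 : 0 < x)
    (hx1 : x ≤ 1) (hw : 1 ≤ Fintype.card V * x ^ (i + 1)) {e : Sym2 V} (he : ¬e.IsDiag) :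
    bernoulliMean (edgesOn univ) x (fun S => (discreteDeriv e (onEdges (cliqueCount (i + 1))) S -
        meanInfluence (Fintype.card V) i x) ^ 2) ≤
      i * 2 ^ (i + 2) * extensionScale (Fintype.card V) x i ^ 2 /
        (Fintype.card V * x ^ (i + 1)) := by
  have term_le : ∀ l ∈ Icc 1 i, extensionScale (Fintype.card V) x i ^ 2 /
      extensionScale (Fintype.card V) x l ≤
        extensionScale (Fintype.card V) x i ^ 2 / (Fintype.card V * x ^ (i + 1)) := fun l hl => by
    obtain ⟨hl1, hl⟩ := mem_Icc.1 hl
    exact div_le_div_of_nonneg_left (sq_nonneg _) (zero_lt_one.trans_le hw)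
      (le_extensionScale hx0.le hx1 hw hl1 hl)
  calc _ ≤ _ := bernoulliMean_sq_discreteDeriv_cliqueCount_sub_le i hx0 he
    _ ≤ 2 ^ (i + 2) * (i * (extensionScale (Fintype.card V) x i ^ 2 /
          (Fintype.card V * x ^ (i + 1)))) := by
        gcongr
        simpa using sum_le_card_nsmul _ _ _ term_le
    _ = _ := by ring

theorem bernoulliMean_sq_discreteDeriv_cliqueCount_succ_le {i : ℕ} {x : ℝ} (hx0 : 0 < x)
    (hx1 : x ≤ 1) (hw : 1 ≤ Fintype.card V * x ^ (i + 1)) {e : Sym2 V} (he : ¬e.IsDiag) :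
    bernoulliMean (edgesOn univ) x
        (fun S => discreteDeriv e (onEdges (cliqueCount (i + 2))) S ^ 2) ≤
      (i + 2) * 2 ^ (i + 3) * extensionScale (Fintype.card V) x i ^ 2 *
        ((Fintype.card V * x ^ (i + 2)) ^ 2 + Fintype.card V * x ^ (i + 2)) := by
  have card_pos : 0 < Fintype.card V := by
    induction e with
    | h a b => exact Fintype.card_pos_iff.2 ⟨a⟩
  set v : ℝ := Fintype.card V * x ^ (i + 2)
  set μ := extensionScale (Fintype.card V) x
  have hv : 0 < v := by positivity
  have scale_succ : μ (i + 1) = μ i * v := extensionScale_succ _ _ _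
  have one_le : ∀ l ≤ i, 1 ≤ μ l := fun l hl => one_le_extensionScale hx0.le hx1 hw hl
  have term_le : ∀ l ∈ range (i + 2), μ (i + 1) ^ 2 / μ l ≤ μ i ^ 2 * (v ^ 2 + v) := fun l hl => by
    rw [div_le_iff₀ (extensionScale_pos card_pos hx0 l), scale_succ, mul_pow, mul_assoc]
    refine mul_le_mul_of_nonneg_left ?_ (sq_nonneg _)
    obtain hl | rfl := (Nat.lt_succ_iff.1 (mem_range.1 hl)).lt_or_eq
    · have := one_le l (Nat.lt_succ_iff.1 hl)
      nlinarith [sq_nonneg v]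
    · have := one_le i le_rfl
      change v ^ 2 ≤ (v ^ 2 + v) * μ (i + 1)
      rw [scale_succ]
      nlinarith [mul_pos hv hv, mul_pos hv (mul_pos hv hv)]
  calc _ ≤ _ := bernoulliMean_sq_discreteDeriv_cliqueCount_le (i + 1) hx0 he
    _ ≤ 2 ^ (i + 3) * ((i + 2) * (μ i ^ 2 * (v ^ 2 + v))) := by
        gcongr
        simpa using sum_le_card_nsmul _ _ _ term_le
    _ = _ := by ring

end CliqueInfluence

section BettiDerivative

open Finset SimpleGraph

variable {V : Type*} [LinearOrder V] [Finite V]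

theorem isSupermodular_onEdges_cliqueNullity (k : ℕ) :
    IsSupermodular (onEdges (cliqueNullity (V := V) k)) := fun S T => by
  have key := cliqueNullity_add_cliqueNullity_le k (fromEdgeSet (S : Set (Sym2 V)))
    (fromEdgeSet (T : Set (Sym2 V)))
  rw [← fromEdgeSet_union, ← fromEdgeSet_inter, ← coe_union, ← coe_inter] at key
  unfold onEdges
  exact_mod_cast key

theorem onEdges_cliqueNullity_add_cliqueRank (k : ℕ) (S : Finset (Sym2 V)) :
    onEdges (cliqueNullity k) S + onEdges (cliqueRank k) S = onEdges (cliqueCount k) S := by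
  unfold onEdges
  exact_mod_cast cliqueNullity_add_cliqueRank k (fromEdgeSet (S : Set (Sym2 V)))

theorem discreteDeriv_cliqueNullity_add_cliqueRank (k : ℕ) (e : Sym2 V) (S : Finset (Sym2 V)) :
    discreteDeriv e (onEdges (cliqueNullity k)) S + discreteDeriv e (onEdges (cliqueRank k)) S =
      discreteDeriv e (onEdges (cliqueCount k)) S := by
  rw [← discreteDeriv_add, funext (onEdges_cliqueNullity_add_cliqueRank k)]

/-- The `k`-th Betti number of the clique complex of a graph; on the vertex set `Fin n` its
real-valued version is `cliqueBetti`. -/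
noncomputable def cliqueComplexBetti (k : ℕ) (G : SimpleGraph V) : ℕ := G.cliqueComplex.betti k

theorem discreteDeriv_cliqueComplexBetti (k : ℕ) (e : Sym2 V) (S : Finset (Sym2 V)) :
    discreteDeriv e (onEdges (cliqueComplexBetti (k + 1))) S =
      discreteDeriv e (onEdges (cliqueCount (k + 1))) S -
        discreteDeriv e (onEdges (cliqueRank (k + 1))) S -
        discreteDeriv e (onEdges (cliqueRank (k + 2))) S := by
  have betti_add_rank : ∀ S : Finset (Sym2 V), onEdges (cliqueComplexBetti (k + 1)) S +
      onEdges (cliqueRank (k + 2)) S = onEdges (cliqueNullity (k + 1)) S := fun S => by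
    unfold onEdges cliqueComplexBetti
    exact_mod_cast betti_cliqueComplex_add_cliqueRank k (fromEdgeSet (S : Set (Sym2 V)))
  have deriv_add := discreteDeriv_add e (onEdges (cliqueComplexBetti (k + 1)))
    (onEdges (cliqueRank (k + 2))) S
  rw [funext betti_add_rank] at deriv_add
  linarith [discreteDeriv_cliqueNullity_add_cliqueRank (k + 1) e S]

theorem discreteDeriv_cliqueRank_nonneg (k : ℕ) (e : Sym2 V) (S : Finset (Sym2 V)) :
    0 ≤ discreteDeriv e (onEdges (cliqueRank k)) S :=
  discreteDeriv_nonneg_of_monotone (onEdges_mono (cliqueRank_mono k)) e S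

theorem discreteDeriv_cliqueRank_le (k : ℕ) (e : Sym2 V) (S : Finset (Sym2 V)) :
    discreteDeriv e (onEdges (cliqueRank k)) S ≤ discreteDeriv e (onEdges (cliqueCount k)) S := by
  rw [← discreteDeriv_cliqueNullity_add_cliqueRank]
  exact le_add_of_nonneg_left
    (discreteDeriv_nonneg_of_monotone (onEdges_mono (cliqueNullity_mono k)) e S)

theorem sq_discreteDeriv_cliqueComplexBetti_sub_le (k : ℕ) (m : ℝ) (e : Sym2 V)
    (S : Finset (Sym2 V)) :
    (discreteDeriv e (onEdges (cliqueComplexBetti (k + 1))) S - m) ^ 2 ≤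
      3 * (2 * (discreteDeriv e (onEdges (cliqueCount (k + 1))) S - m) ^ 2 +
        2 * m * discreteDeriv e (onEdges (cliqueRank (k + 1))) S +
        discreteDeriv e (onEdges (cliqueRank (k + 2))) S ^ 2) := by
  have rank_nonneg := discreteDeriv_cliqueRank_nonneg (k + 1) e S
  have rank_le := discreteDeriv_cliqueRank_le (k + 1) e S
  rw [discreteDeriv_cliqueComplexBetti]
  set f := discreteDeriv e (onEdges (cliqueCount (k + 1))) S
  set r := discreteDeriv e (onEdges (cliqueRank (k + 1))) S
  set r' := discreteDeriv e (onEdges (cliqueRank (k + 2))) S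
  have rank_sq_le : r ^ 2 ≤ 2 * m * r + (f - m) ^ 2 := by
    nlinarith [sq_nonneg (f - m - r), mul_nonneg rank_nonneg (sub_nonneg.2 rank_le)]
  have three_sq : (f - r - r' - m) ^ 2 ≤ 3 * ((f - m) ^ 2 + r ^ 2 + r' ^ 2) := by
    nlinarith [sq_nonneg (f - m + r), sq_nonneg (f - m + r'), sq_nonneg (r - r')]
  linarith

theorem bernoulliMean_sq_discreteDeriv_cliqueComplexBetti_sub_le (k : ℕ) (m : ℝ) {x : ℝ}
    (hx0 : 0 ≤ x) (hx1 : x ≤ 1) (U : Finset (Sym2 V)) (e : Sym2 V) :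
    bernoulliMean U x
        (fun S => (discreteDeriv e (onEdges (cliqueComplexBetti (k + 1))) S - m) ^ 2) ≤
      3 * (2 * bernoulliMean U x
          (fun S => (discreteDeriv e (onEdges (cliqueCount (k + 1))) S - m) ^ 2) +
        2 * m * bernoulliMean U x (discreteDeriv e (onEdges (cliqueRank (k + 1)))) +
        bernoulliMean U x (fun S => discreteDeriv e (onEdges (cliqueCount (k + 2))) S ^ 2)) := by
  rw [← bernoulliMean_const_mul, ← bernoulliMean_const_mul, ← bernoulliMean_add,
    ← bernoulliMean_add, ← bernoulliMean_const_mul]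
  refine bernoulliMean_mono hx0 hx1 fun S _ =>
    (sq_discreteDeriv_cliqueComplexBetti_sub_le k m e S).trans ?_
  have rank_nonneg := discreteDeriv_cliqueRank_nonneg (k + 2) e S
  have rank_le := discreteDeriv_cliqueRank_le (k + 2) e S
  gcongr

end BettiDerivative

section Linearization

open Finset SimpleGraph

theorem one_sub_pow_le (K : ℕ) {δ : ℝ} (h0 : 0 ≤ δ) (h1 : δ ≤ 1) :
    (1 - δ) ^ K ≤ 1 - K * δ + (K * δ) ^ 2 := by
  have bernoulli : 1 + K * δ ≤ (1 + δ) ^ K := one_add_mul_le_pow (by linarith) K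
  have mul_le_one : (1 - δ) ^ K * (1 + K * δ) ≤ 1 :=
    calc (1 - δ) ^ K * (1 + K * δ) ≤ (1 - δ) ^ K * (1 + δ) ^ K :=
          mul_le_mul_of_nonneg_left bernoulli (pow_nonneg (sub_nonneg.2 h1) K)
      _ = (1 - δ ^ 2) ^ K := by rw [← mul_pow]; ring
      _ ≤ 1 := pow_le_one₀ (by nlinarith) (by nlinarith)
  have mul_nonneg : 0 ≤ K * δ := by positivity
  refine le_of_mul_le_mul_right (mul_le_one.trans ?_) (by positivity : 0 < 1 + K * δ)
  nlinarith [pow_nonneg mul_nonneg 3]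

theorem meanInfluence_nonneg (n i : ℕ) {x : ℝ} (hx : 0 ≤ x) : 0 ≤ meanInfluence n i x := by
  unfold meanInfluence
  positivity

theorem extensionScale_sq_le {n i : ℕ} (hn : 2 * (i + 2) ≤ n) {x : ℝ} (hx : 0 ≤ x) :
    extensionScale n x i ^ 2 ≤ (2 ^ i * i.factorial) ^ 2 * meanInfluence n i x ^ 2 := by
  have pow_le : n ^ i ≤ 2 ^ i * i.factorial * (n - 2).choose i :=
    calc n ^ i ≤ (2 * (n - 2 + 1 - i)) ^ i := Nat.pow_le_pow_left (by omega) i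
      _ = 2 ^ i * (n - 2 + 1 - i) ^ i := mul_pow _ _ _
      _ ≤ 2 ^ i * (n - 2).descFactorial i :=
        Nat.mul_le_mul_left _ (Nat.pow_sub_le_descFactorial (n - 2) i)
      _ = 2 ^ i * i.factorial * (n - 2).choose i := by
        rw [Nat.descFactorial_eq_factorial_mul_choose, mul_assoc]
  have cast_pow_le : (n : ℝ) ^ i ≤ 2 ^ i * i.factorial * (n - 2).choose i := by
    exact_mod_cast pow_le
  rw [← mul_pow, extensionScale, meanInfluence, ← mul_assoc]
  gcongr

theorem choose_mul_pow_le {n i : ℕ} (hn : 2 * (i + 2) ≤ n) {x : ℝ} (hx : 0 < x) :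
    n.choose (i + 1) * x ^ (i + 1).choose 2 ≤
      4 * (n.choose 2 * meanInfluence n i x * x) / (n * x ^ (i + 1)) := by
  have pascal : (i + 2).choose 2 = (i + 1).choose 2 + (i + 1) := by
    rw [Nat.choose_succ_succ' (i + 1) 1, Nat.choose_one_right, add_comm]
  have choose_mul_le : n.choose (i + 1) * n ≤ 4 * ((i + 2).choose 2 * n.choose (i + 2)) :=
    calc n.choose (i + 1) * n ≤ n.choose (i + 1) * (2 * (n - (i + 1))) :=
          Nat.mul_le_mul_left _ (by omega)
      _ = 2 * (n.choose (i + 1) * (n - (i + 1))) := by ring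
      _ = 2 * (i + 2) * n.choose (i + 2) := by rw [← Nat.choose_succ_right_eq]; ring
      _ ≤ 4 * (i + 2).choose 2 * n.choose (i + 2) := Nat.mul_le_mul_right _ (by omega)
      _ = 4 * ((i + 2).choose 2 * n.choose (i + 2)) := mul_assoc _ _ _
  have cast_choose_mul_le :
      (n.choose (i + 1) : ℝ) * n ≤ 4 * ((i + 2).choose 2 * n.choose (i + 2)) := by
    exact_mod_cast choose_mul_le
  have n_pos : (0 : ℝ) < n := by exact_mod_cast (by omega : 0 < n)
  rw [le_div_iff₀ (by positivity), choose_two_mul_meanInfluence]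
  calc n.choose (i + 1) * x ^ (i + 1).choose 2 * (n * x ^ (i + 1))
      = n.choose (i + 1) * n * x ^ (i + 2).choose 2 := by rw [pascal, pow_add]; ring
    _ ≤ 4 * ((i + 2).choose 2 * n.choose (i + 2)) * x ^ (i + 2).choose 2 := by gcongr
    _ = 4 * ((i + 2).choose 2 * (n.choose (i + 2) * x ^ (i + 2).choose 2)) := by ring

variable {V : Type*} [LinearOrder V] [Fintype V]

theorem bernoulliMean_cliqueNullity_le (k : ℕ) {x : ℝ} (hx0 : 0 ≤ x) (hx1 : x ≤ 1) :
    bernoulliMean (edgesOn (univ : Finset V)) x (onEdges (cliqueNullity k)) ≤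
      (Fintype.card V).choose (k + 1) * x ^ (k + 1).choose 2 := by
  rw [← bernoulliMean_cliqueCount]
  refine bernoulliMean_mono hx0 hx1 fun S _ => ?_
  rw [← onEdges_cliqueNullity_add_cliqueRank]
  exact le_add_of_nonneg_right (Nat.cast_nonneg _)

theorem sub_le_bernoulliMean_cliqueNullity (k : ℕ) {x : ℝ} (hx0 : 0 ≤ x) (hx1 : x ≤ 1) :
    (Fintype.card V).choose (k + 2) * x ^ (k + 2).choose 2 -
        (Fintype.card V).choose (k + 1) * x ^ (k + 1).choose 2 ≤
      bernoulliMean (edgesOn (univ : Finset V)) x (onEdges (cliqueNullity (k + 1))) := by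
  rw [← bernoulliMean_cliqueCount, ← bernoulliMean_cliqueCount, ← bernoulliMean_sub]
  refine bernoulliMean_mono hx0 hx1 fun S _ => ?_
  have rank_le : onEdges (cliqueRank (k + 1)) S ≤ onEdges (cliqueCount k) S :=
    Nat.cast_le.2 (cliqueRank_succ_le k _)
  linarith [onEdges_cliqueNullity_add_cliqueRank (k + 1) S]

theorem sum_bernoulliMean_discreteDeriv_cliqueCount (i : ℕ) (x : ℝ) :
    ∑ e ∈ edgesOn (univ : Finset V),
        bernoulliMean (edgesOn univ) x (discreteDeriv e (onEdges (cliqueCount (i + 1)))) =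
      (Fintype.card V).choose 2 * meanInfluence (Fintype.card V) i x := by
  rw [sum_congr rfl fun e he => bernoulliMean_discreteDeriv_cliqueCount i x (mem_edgesOn.1 he).2,
    sum_const, card_edgesOn, card_univ, nsmul_eq_mul]

-- The mean nullity is close to the mean clique count at both `x` and `(1 - δ) * x`, and convexity
-- bounds its derivative at `x` from below by its slope between these two points.
theorem le_sum_bernoulliMean_discreteDeriv_cliqueNullity {i : ℕ}
    (hn : 2 * (i + 2) ≤ Fintype.card V) {x δ : ℝ} (hx0 : 0 < x) (hx1 : x ≤ 1) (hδ0 : 0 < δ)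
    (hδ1 : δ ≤ 1) :
    (Fintype.card V).choose 2 * meanInfluence (Fintype.card V) i x *
        (1 - (i + 2).choose 2 * δ - 4 / (Fintype.card V * x ^ (i + 1) * δ)) ≤
      ∑ e ∈ edgesOn (univ : Finset V),
        bernoulliMean (edgesOn univ) x (discreteDeriv e (onEdges (cliqueNullity (i + 1)))) := by
  have n_pos : (0 : ℝ) < Fintype.card V := by exact_mod_cast (by omega : 0 < Fintype.card V)
  have shrink_nonneg : 0 ≤ (1 - δ) * x := mul_nonneg (by linarith) hx0.le
  have shrink_le : (1 - δ) * x ≤ x := by nlinarith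
  have convexity := (isSupermodular_onEdges_cliqueNullity (V := V) (i + 1)).bernoulliMean_sub_le
    shrink_nonneg shrink_le hx1 (edgesOn univ)
  have upper := bernoulliMean_cliqueNullity_le (V := V) (i + 1) shrink_nonneg (shrink_le.trans hx1)
  have lower := sub_le_bernoulliMean_cliqueNullity (V := V) i hx0.le hx1
  have mean_eq := choose_two_mul_meanInfluence (Fintype.card V) i x
  have mean_le := choose_mul_pow_le hn hx0
  set P := (Fintype.card V).choose 2 * meanInfluence (Fintype.card V) i x
  set K := (i + 2).choose 2
  set F : ℝ := (Fintype.card V).choose (i + 2) * x ^ K with F_eq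
  set w := Fintype.card V * x ^ (i + 1)
  have w_pos : 0 < w := by positivity
  have F_nonneg : 0 ≤ F := by positivity
  have shrink_pow : F * (1 - δ) ^ K ≤ F * (1 - K * δ + (K * δ) ^ 2) :=
    mul_le_mul_of_nonneg_left (one_sub_pow_le K hδ0.le hδ1) F_nonneg
  have shrink_mean :
      (Fintype.card V).choose (i + 2) * ((1 - δ) * x) ^ K = F * (1 - δ) ^ K := by
    rw [mul_pow, F_eq]
    ring
  refine le_of_mul_le_mul_left ?_ (mul_pos hδ0 hx0)
  calc δ * x * (P * (1 - K * δ - 4 / (w * δ)))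
      = P * x * (δ - K * δ ^ 2) - 4 * (P * x) / w := by field_simp
    _ = F - F * (1 - K * δ + (K * δ) ^ 2) - 4 * (P * x) / w := by rw [mean_eq]; ring
    _ ≤ _ := by linarith

theorem sum_bernoulliMean_discreteDeriv_cliqueRank_le {i : ℕ} (hn : 2 * (i + 2) ≤ Fintype.card V)
    {x δ : ℝ} (hx0 : 0 < x) (hx1 : x ≤ 1) (hδ0 : 0 < δ) (hδ1 : δ ≤ 1) :
    ∑ e ∈ edgesOn (univ : Finset V),
        bernoulliMean (edgesOn univ) x (discreteDeriv e (onEdges (cliqueRank (i + 1)))) ≤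
      (Fintype.card V).choose 2 * meanInfluence (Fintype.card V) i x *
        ((i + 2).choose 2 * δ + 4 / (Fintype.card V * x ^ (i + 1) * δ)) := by
  have count_eq := sum_bernoulliMean_discreteDeriv_cliqueCount (V := V) i x
  simp only [← funext (discreteDeriv_cliqueNullity_add_cliqueRank (i + 1) _), bernoulliMean_add,
    sum_add_distrib] at count_eq
  linarith [le_sum_bernoulliMean_discreteDeriv_cliqueNullity hn hx0 hx1 hδ0 hδ1]

end Linearization

section BettiLinearization

open Finset SimpleGraph

variable {V : Type*} [LinearOrder V] [Fintype V]

/-- A bound for the relative error made when a Betti number of the clique complex of the binomial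
random graph is replaced by a multiple of the number of edges. -/
noncomputable def linearizationError (n i : ℕ) (x : ℝ) : ℝ :=
  3 * (2 * (i * 2 ^ (i + 2) * (2 ^ i * i.factorial) ^ 2 / (n * x ^ (i + 1))) +
    2 * (((i + 2).choose 2 + 4) / √(n * x ^ (i + 1))) +
    (i + 2) * 2 ^ (i + 3) * (2 ^ i * i.factorial) ^ 2 *
      ((n * x ^ (i + 2)) ^ 2 + n * x ^ (i + 2)))

-- The choice `δ = 1 / √(n x ^ (i + 1))` balances the two error terms.
theorem sum_bernoulliMean_discreteDeriv_cliqueRank_le_div_sqrt {i : ℕ}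
    (hn : 2 * (i + 2) ≤ Fintype.card V) {x : ℝ} (hx0 : 0 < x) (hx1 : x ≤ 1)
    (hw : 1 ≤ Fintype.card V * x ^ (i + 1)) :
    ∑ e ∈ edgesOn (univ : Finset V),
        bernoulliMean (edgesOn univ) x (discreteDeriv e (onEdges (cliqueRank (i + 1)))) ≤
      (Fintype.card V).choose 2 * meanInfluence (Fintype.card V) i x *
        (((i + 2).choose 2 + 4) / √(Fintype.card V * x ^ (i + 1))) := by
  have sqrt_pos : 0 < √(Fintype.card V * x ^ (i + 1)) := Real.sqrt_pos.2 (zero_lt_one.trans_le hw)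
  have error_eq : (i + 2).choose 2 * (√(Fintype.card V * x ^ (i + 1)))⁻¹ +
      4 / (Fintype.card V * x ^ (i + 1) * (√(Fintype.card V * x ^ (i + 1)))⁻¹) =
        ((i + 2).choose 2 + 4) / √(Fintype.card V * x ^ (i + 1)) := by
    nth_rw 2 [← Real.mul_self_sqrt (zero_le_one.trans hw)]
    field_simp
  rw [← error_eq]
  exact sum_bernoulliMean_discreteDeriv_cliqueRank_le hn hx0 hx1 (inv_pos.2 sqrt_pos)
    (inv_le_one_of_one_le₀ (Real.one_le_sqrt.2 hw))

theorem sum_bernoulliMean_sq_discreteDeriv_cliqueComplexBetti_sub_le {i : ℕ}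
    (hn : 2 * (i + 2) ≤ Fintype.card V) {x : ℝ} (hx0 : 0 < x) (hx1 : x ≤ 1)
    (hw : 1 ≤ Fintype.card V * x ^ (i + 1)) :
    ∑ e ∈ edgesOn (univ : Finset V), bernoulliMean (edgesOn univ) x (fun S =>
      (discreteDeriv e (onEdges (cliqueComplexBetti (i + 1))) S -
        meanInfluence (Fintype.card V) i x) ^ 2) ≤
      (Fintype.card V).choose 2 * meanInfluence (Fintype.card V) i x ^ 2 *
        linearizationError (Fintype.card V) i x := by
  have scale_sq_le := extensionScale_sq_le hn hx0.le
  have rank_le := sum_bernoulliMean_discreteDeriv_cliqueRank_le_div_sqrt hn hx0 hx1 hw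
  have m_nonneg := meanInfluence_nonneg (Fintype.card V) i hx0.le
  set m := meanInfluence (Fintype.card V) i x
  set c : ℝ := 2 ^ i * i.factorial
  set w := Fintype.card V * x ^ (i + 1)
  set v := Fintype.card V * x ^ (i + 2)
  have count_sub_le : ∀ e ∈ edgesOn (univ : Finset V), bernoulliMean (edgesOn univ) x
      (fun S => (discreteDeriv e (onEdges (cliqueCount (i + 1))) S - m) ^ 2) ≤
        i * 2 ^ (i + 2) * (c ^ 2 * m ^ 2) / w := fun e he =>
    (bernoulliMean_sq_discreteDeriv_cliqueCount_sub_le_div hx0 hx1 hw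
      (mem_edgesOn.1 he).2).trans (by gcongr)
  have count_succ_le : ∀ e ∈ edgesOn (univ : Finset V), bernoulliMean (edgesOn univ) x
      (fun S => discreteDeriv e (onEdges (cliqueCount (i + 2))) S ^ 2) ≤
        (i + 2) * 2 ^ (i + 3) * (c ^ 2 * m ^ 2) * (v ^ 2 + v) := fun e he =>
    (bernoulliMean_sq_discreteDeriv_cliqueCount_succ_le hx0 hx1 hw
      (mem_edgesOn.1 he).2).trans (by gcongr)
  calc _ ≤ _ := sum_le_sum fun e _ =>
        bernoulliMean_sq_discreteDeriv_cliqueComplexBetti_sub_le i m hx0.le hx1 _ e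
    _ ≤ 3 * (2 * ∑ e ∈ edgesOn (univ : Finset V), i * 2 ^ (i + 2) * (c ^ 2 * m ^ 2) / w +
        2 * m * ((Fintype.card V).choose 2 * m * (((i + 2).choose 2 + 4) / √w)) +
        ∑ e ∈ edgesOn (univ : Finset V),
          (i + 2) * 2 ^ (i + 3) * (c ^ 2 * m ^ 2) * (v ^ 2 + v)) := by
        rw [← mul_sum, sum_add_distrib, sum_add_distrib, ← mul_sum, ← mul_sum]
        gcongr with e he e he
        · exact count_sub_le e he
        · exact count_succ_le e he
    _ = _ := by
        rw [sum_const, sum_const, card_edgesOn, card_univ, nsmul_eq_mul, nsmul_eq_mul,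
          linearizationError]
        ring

theorem bernoulliMean_sq_cliqueComplexBetti_sub_card_le {i : ℕ}
    (hn : 2 * (i + 2) ≤ Fintype.card V) {x : ℝ} (hx0 : 0 < x) (hx1 : x ≤ 1)
    (hw : 1 ≤ Fintype.card V * x ^ (i + 1)) :
    bernoulliMean (edgesOn (univ : Finset V)) x (fun S =>
      (onEdges (cliqueComplexBetti (i + 1)) S -
          bernoulliMean (edgesOn (univ : Finset V)) x (onEdges (cliqueComplexBetti (i + 1))) -
        meanInfluence (Fintype.card V) i x * (#S - #(edgesOn (univ : Finset V)) * x)) ^ 2) ≤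
      meanInfluence (Fintype.card V) i x ^ 2 * (#(edgesOn (univ : Finset V)) * x * (1 - x)) *
        linearizationError (Fintype.card V) i x := by
  set β : Finset (Sym2 V) → ℝ := onEdges (cliqueComplexBetti (i + 1))
  set m := meanInfluence (Fintype.card V) i x
  set U := edgesOn (univ : Finset V) with hU
  have mean_eq : bernoulliMean U x (fun S => β S - m * #S) =
      bernoulliMean U x β - m * (#U * x) := by
    rw [bernoulliMean_sub, bernoulliMean_const_mul, bernoulliMean_card]
  calc _ = bernoulliMean U x (fun S => (β S - m * #S) ^ 2) -
          bernoulliMean U x (fun S => β S - m * #S) ^ 2 := by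
        rw [← bernoulliMean_sub_mean_sq, mean_eq]
        exact bernoulliMean_congr x fun S _ => by ring
    _ ≤ x * (1 - x) * ∑ e ∈ U, bernoulliMean U x (fun S => (discreteDeriv e β S - m) ^ 2) := by
        simp only [← discreteDeriv_sub_const_mul_card]
        exact bernoulliMean_sq_sub_sq_bernoulliMean_le hx0.le hx1 _ _
    _ ≤ x * (1 - x) * (#U * m ^ 2 * linearizationError (Fintype.card V) i x) := by
        rw [hU, card_edgesOn, card_univ]
        have := sub_nonneg.2 hx1
        gcongr
        exact sum_bernoulliMean_sq_discreteDeriv_cliqueComplexBetti_sub_le hn hx0 hx1 hw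
    _ = _ := by ring

end BettiLinearization

section CharFun

open Finset

theorem norm_pow_sub_pow_le_mul {R : Type*} [SeminormedRing R] [NormOneClass R] {a b : R}
    (ha : ‖a‖ ≤ 1) (hb : ‖b‖ ≤ 1) (n : ℕ) : ‖a ^ n - b ^ n‖ ≤ n * ‖a - b‖ := by
  induction n with
  | zero => simp
  | succ n ih =>
    have telescope : a ^ (n + 1) - b ^ (n + 1) = a * (a ^ n - b ^ n) + (a - b) * b ^ n := by
      rw [pow_succ', pow_succ', mul_sub, sub_mul, sub_add_sub_cancel]
    have pow_le : ‖b ^ n‖ ≤ 1 := (norm_pow_le b n).trans (pow_le_one₀ (norm_nonneg b) hb)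
    calc ‖a ^ (n + 1) - b ^ (n + 1)‖ ≤ ‖a‖ * ‖a ^ n - b ^ n‖ + ‖a - b‖ * ‖b ^ n‖ := by
          rw [telescope]
          exact (norm_add_le _ _).trans (add_le_add (norm_mul_le _ _) (norm_mul_le _ _))
      _ ≤ 1 * (n * ‖a - b‖) + ‖a - b‖ * 1 := by gcongr
      _ = (n + 1 : ℕ) * ‖a - b‖ := by push_cast; ring

theorem norm_exp_ofReal_mul_I_sub_taylor_le {y : ℝ} (hy : |y| ≤ 1) :
    ‖Complex.exp (y * Complex.I) - (1 + y * Complex.I - y ^ 2 / 2)‖ ≤ 3 * |y| ^ 3 := by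
  have taylor_eq : ∑ m ∈ range 3, (y * Complex.I) ^ m / (m.factorial : ℂ) =
      1 + y * Complex.I - y ^ 2 / 2 := by
    simp only [sum_range_succ, range_zero, sum_empty, Nat.factorial, mul_pow, Complex.I_sq]
    push_cast
    ring
  have norm_eq : ‖(y * Complex.I : ℂ)‖ = |y| := by
    rw [norm_mul, Complex.norm_I, mul_one, Complex.norm_real, Real.norm_eq_abs]
  have exp_le : Real.exp |y| ≤ 3 :=
    (Real.exp_le_exp.2 hy).trans (Real.exp_one_lt_d9.le.trans (by norm_num))
  calc _ ≤ |y| ^ 3 * Real.exp |y| := by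
        rw [← taylor_eq, ← norm_eq]
        exact Complex.norm_exp_sub_sum_le_norm_mul_exp _ 3
    _ ≤ |y| ^ 3 * 3 := by gcongr
    _ = _ := mul_comm _ _

/-- The characteristic function at `u` of a centered Bernoulli variable of success
probability `x`. -/
noncomputable def centeredBernoulliCharFun (x u : ℝ) : ℂ :=
  x * Complex.exp ((u * (1 - x) : ℝ) * Complex.I) +
    (1 - x : ℝ) * Complex.exp ((-(u * x) : ℝ) * Complex.I)

theorem norm_centeredBernoulliCharFun_le_one {x : ℝ} (hx0 : 0 ≤ x) (hx1 : x ≤ 1) (u : ℝ) :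
    ‖centeredBernoulliCharFun x u‖ ≤ 1 := by
  refine (norm_add_le _ _).trans_eq ?_
  rw [norm_mul, norm_mul, Complex.norm_exp_ofReal_mul_I, Complex.norm_exp_ofReal_mul_I,
    Complex.norm_real, Complex.norm_real, Real.norm_of_nonneg hx0,
    Real.norm_of_nonneg (sub_nonneg.2 hx1)]
  ring

theorem norm_centeredBernoulliCharFun_sub_le {x u : ℝ} (hx0 : 0 ≤ x) (hx1 : x ≤ 1)
    (hu : |u| ≤ 1) :
    ‖centeredBernoulliCharFun x u - (1 - u ^ 2 * (x * (1 - x)) / 2 : ℝ)‖ ≤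
      3 * |u| ^ 3 * (x * (1 - x)) := by
  have hx : 0 ≤ 1 - x := sub_nonneg.2 hx1
  have abs_success : |u * (1 - x)| = |u| * (1 - x) := by rw [abs_mul, abs_of_nonneg hx]
  have abs_failure : |-(u * x)| = |u| * x := by rw [abs_neg, abs_mul, abs_of_nonneg hx0]
  have taylor_success := norm_exp_ofReal_mul_I_sub_taylor_le (y := u * (1 - x))
    (abs_success ▸ mul_le_one₀ hu hx (sub_le_self 1 hx0))
  have taylor_failure := norm_exp_ofReal_mul_I_sub_taylor_le (y := -(u * x))
    (abs_failure ▸ mul_le_one₀ hu hx0 hx1)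
  rw [abs_success] at taylor_success
  rw [abs_failure] at taylor_failure
  have split : centeredBernoulliCharFun x u - (1 - u ^ 2 * (x * (1 - x)) / 2 : ℝ) =
      x * (Complex.exp ((u * (1 - x) : ℝ) * Complex.I) -
          (1 + (u * (1 - x) : ℝ) * Complex.I - (u * (1 - x) : ℝ) ^ 2 / 2)) +
        (1 - x : ℝ) * (Complex.exp ((-(u * x) : ℝ) * Complex.I) -
          (1 + (-(u * x) : ℝ) * Complex.I - (-(u * x) : ℝ) ^ 2 / 2)) := by
    rw [centeredBernoulliCharFun]
    push_cast
    ring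
  calc _ ≤ x * (3 * (|u| * (1 - x)) ^ 3) + (1 - x) * (3 * (|u| * x) ^ 3) := by
        rw [split]
        refine (norm_add_le _ _).trans ?_
        rw [norm_mul, norm_mul, Complex.norm_real, Complex.norm_real, Real.norm_of_nonneg hx0,
          Real.norm_of_nonneg hx]
        gcongr
    _ = 3 * |u| ^ 3 * (x * (1 - x)) * (1 - 2 * (x * (1 - x))) := by ring
    _ ≤ 3 * |u| ^ 3 * (x * (1 - x)) :=
        mul_le_of_le_one_right (by positivity) (sub_le_self 1 (by positivity))

theorem norm_one_sub_sub_exp_neg_le {v : ℝ} (hv0 : 0 ≤ v) (hv1 : v ≤ 1) :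
    ‖((1 - v : ℝ) : ℂ) - (Real.exp (-v) : ℝ)‖ ≤ v ^ 2 := by
  have taylor := Real.abs_exp_sub_one_sub_id_le (x := -v) (by rwa [abs_neg, abs_of_nonneg hv0])
  rw [neg_sq, sub_sub, ← sub_eq_add_neg] at taylor
  rwa [← Complex.ofReal_sub, Complex.norm_real, Real.norm_eq_abs, abs_sub_comm]

variable {α : Type*} {U : Finset α} {x : ℝ}

theorem bernoulliMean_exp_mul_card_sub_mean (U : Finset α) (x u : ℝ) :
    bernoulliMean U x (fun S => Complex.exp ((u * (#S - #U * x) : ℝ) * Complex.I)) =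
      centeredBernoulliCharFun x u ^ #U := by
  set c := Complex.exp ((-(u * x) : ℝ) * Complex.I) with hc
  have factor : ∀ S : Finset α, Complex.exp ((u * (#S - #U * x) : ℝ) * Complex.I) =
      c ^ #U * Complex.exp (u * Complex.I) ^ #S := fun S => by
    rw [hc, ← Complex.exp_nat_mul, ← Complex.exp_nat_mul, ← Complex.exp_add]
    congr 1
    push_cast
    ring
  have success_eq : Complex.exp ((u * (1 - x) : ℝ) * Complex.I) =
      Complex.exp (u * Complex.I) * c := by
    rw [hc, ← Complex.exp_add]
    congr 1
    push_cast
    ring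
  have pull_out : bernoulliMean U x (fun S => c ^ #U * Complex.exp (u * Complex.I) ^ #S) =
      c ^ #U * bernoulliMean U x (fun S => Complex.exp (u * Complex.I) ^ #S) := by
    simp only [bernoulliMean, mul_sum, mul_smul_comm]
  simp only [factor]
  rw [pull_out, bernoulliMean_pow_card, centeredBernoulliCharFun, ← hc, success_eq, ← mul_pow,
    Complex.ofReal_sub, Complex.ofReal_one]
  ring

theorem norm_bernoulliMean_exp_mul_card_sub_le {u : ℝ} (hx0 : 0 ≤ x) (hx1 : x ≤ 1)
    (hu : |u| ≤ 1) :
    ‖bernoulliMean U x (fun S => Complex.exp ((u * (#S - #U * x) : ℝ) * Complex.I)) -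
      (Real.exp (-(u ^ 2 * (#U * x * (1 - x)) / 2)) : ℝ)‖ ≤
        #U * x * (1 - x) * (3 * |u| ^ 3 + u ^ 4) := by
  have hx : 0 ≤ 1 - x := sub_nonneg.2 hx1
  have var_le_one : x * (1 - x) ≤ 1 := mul_le_one₀ hx1 hx (sub_le_self 1 hx0)
  have u_sq_le_one : u ^ 2 ≤ 1 := (sq_le_one_iff_abs_le_one u).2 hu
  set v := u ^ 2 * (x * (1 - x)) / 2 with hv
  have v_nonneg : 0 ≤ v := by positivity
  have v_le_one : v ≤ 1 := by linarith [mul_le_one₀ u_sq_le_one (by positivity) var_le_one]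
  have v_sq_le : v ^ 2 ≤ u ^ 4 * (x * (1 - x)) := by
    have : u ^ 4 * (x * (1 - x)) * (x * (1 - x)) ≤ u ^ 4 * (x * (1 - x)) * 1 := by gcongr
    linarith [show v ^ 2 = u ^ 4 * (x * (1 - x)) * (x * (1 - x)) / 4 by rw [hv]; ring,
      show 0 ≤ u ^ 4 * (x * (1 - x)) by positivity]
  have gaussian_eq : ((Real.exp (-(u ^ 2 * (#U * x * (1 - x)) / 2)) : ℝ) : ℂ) =
      ((Real.exp (-v) : ℝ) : ℂ) ^ #U := by
    rw [← Complex.ofReal_pow, ← Real.exp_nat_mul, hv]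
    ring_nf
  have gaussian_le_one : ‖((Real.exp (-v) : ℝ) : ℂ)‖ ≤ 1 := by
    rw [Complex.norm_real, Real.norm_of_nonneg (Real.exp_pos _).le]
    exact Real.exp_le_one_iff.2 (neg_nonpos.2 v_nonneg)
  rw [bernoulliMean_exp_mul_card_sub_mean, gaussian_eq]
  calc _ ≤ #U * ‖centeredBernoulliCharFun x u - (Real.exp (-v) : ℝ)‖ :=
        norm_pow_sub_pow_le_mul (norm_centeredBernoulliCharFun_le_one hx0 hx1 u) gaussian_le_one _
    _ ≤ #U * (3 * |u| ^ 3 * (x * (1 - x)) + u ^ 4 * (x * (1 - x))) := by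
        gcongr
        exact (norm_sub_le_norm_sub_add_norm_sub _ ((1 - v : ℝ) : ℂ) _).trans (add_le_add
          (norm_centeredBernoulliCharFun_sub_le hx0 hx1 hu)
          ((norm_one_sub_sub_exp_neg_le v_nonneg v_le_one).trans v_sq_le))
    _ = _ := by ring

theorem norm_bernoulliMean_exp_normalized_card_sub_le {s t : ℝ} (hx0 : 0 ≤ x) (hx1 : x ≤ 1)
    (hs : s ^ 2 = #U * x * (1 - x)) (hs0 : 0 < s) (hst : |t| ≤ s) :
    ‖bernoulliMean U x (fun S => Complex.exp ((t * ((#S - #U * x) / s) : ℝ) * Complex.I)) -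
      Complex.exp (-(t ^ 2 / 2))‖ ≤ 3 * |t| ^ 3 / s + t ^ 4 / s ^ 2 := by
  have bound := norm_bernoulliMean_exp_mul_card_sub_le (U := U) (u := t / s) hx0 hx1
    (by rwa [abs_div, abs_of_pos hs0, div_le_one hs0])
  have gaussian_eq : Complex.exp (-(t ^ 2 / 2)) = (Real.exp (-((t / s) ^ 2 * s ^ 2 / 2)) : ℝ) := by
    rw [← mul_pow, div_mul_cancel₀ t hs0.ne']
    push_cast
    rfl
  simp only [← hs, div_mul_eq_mul_div, mul_div_assoc t] at bound
  rw [gaussian_eq]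
  refine bound.trans_eq ?_
  rw [abs_div, abs_of_pos hs0]
  field_simp

theorem norm_bernoulliMean_exp_sub_le (hx0 : 0 ≤ x) (hx1 : x ≤ 1) (t : ℝ) (X Y : Finset α → ℝ) :
    ‖bernoulliMean U x (fun S => Complex.exp ((t * X S : ℝ) * Complex.I)) -
      bernoulliMean U x (fun S => Complex.exp ((t * Y S : ℝ) * Complex.I))‖ ≤
      |t| * √(bernoulliMean U x (fun S => (X S - Y S) ^ 2)) := by
  have norm_exp_sub_le : ∀ S, ‖Complex.exp ((t * X S : ℝ) * Complex.I) -
      Complex.exp ((t * Y S : ℝ) * Complex.I)‖ ≤ |t| * |X S - Y S| := fun S => by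
    have factor : Complex.exp ((t * X S : ℝ) * Complex.I) -
        Complex.exp ((t * Y S : ℝ) * Complex.I) = Complex.exp ((t * Y S : ℝ) * Complex.I) *
          (Complex.exp (Complex.I * (t * (X S - Y S) : ℝ)) - 1) := by
      rw [mul_sub, ← Complex.exp_add, mul_one]
      congr 2
      push_cast
      ring
    rw [factor, norm_mul, Complex.norm_exp_ofReal_mul_I, one_mul, ← abs_mul]
    exact Real.norm_exp_I_mul_ofReal_sub_one_le
  calc _ ≤ bernoulliMean U x (fun S => |t| * |X S - Y S|) := by
        rw [← bernoulliMean_sub]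
        exact (norm_bernoulliMean_le hx0 hx1 _).trans
          (bernoulliMean_mono hx0 hx1 fun S _ => norm_exp_sub_le S)
    _ ≤ |t| * √(bernoulliMean U x (fun S => (X S - Y S) ^ 2)) := by
        rw [bernoulliMean_const_mul]
        refine mul_le_mul_of_nonneg_left (Real.le_sqrt_of_sq_le ?_) (abs_nonneg t)
        simpa only [sq_abs] using sq_bernoulliMean_le hx0 hx1 fun S => |X S - Y S|

theorem half_le_of_bernoulliMean_sq_sub_le (hx0 : 0 ≤ x) (hx1 : x ≤ 1) {A B : Finset α → ℝ}
    {a σ : ℝ} (hσ : 0 ≤ σ) (hA : bernoulliMean U x (fun S => A S ^ 2) = a ^ 2)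
    (hB : bernoulliMean U x (fun S => B S ^ 2) = σ ^ 2)
    (hAB : bernoulliMean U x (fun S => (B S - A S) ^ 2) ≤ a ^ 2 / 4) : a / 2 ≤ σ := by
  have a_sq_le : a ^ 2 ≤ 2 * σ ^ 2 + 2 * bernoulliMean U x (fun S => (B S - A S) ^ 2) := by
    rw [← hA, ← hB, ← bernoulliMean_const_mul, ← bernoulliMean_const_mul, ← bernoulliMean_add]
    exact bernoulliMean_mono hx0 hx1 fun S _ => by nlinarith [sq_nonneg (2 * B S - A S)]
  exact le_of_sq_le_sq (by rw [div_pow]; linarith) hσ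

theorem bernoulliMean_sq_div_sub_div {A B : Finset α → ℝ} {a σ : ℝ} (ha : a ≠ 0) (hσ : σ ≠ 0)
    (hA : bernoulliMean U x (fun S => A S ^ 2) = a ^ 2)
    (hB : bernoulliMean U x (fun S => B S ^ 2) = σ ^ 2) :
    bernoulliMean U x (fun S => (B S / σ - A S / a) ^ 2) =
      (bernoulliMean U x (fun S => (B S - A S) ^ 2) - (σ - a) ^ 2) / (σ * a) := by
  have expand : ∀ S, (B S / σ - A S / a) ^ 2 = (σ * a)⁻¹ * (B S - A S) ^ 2 +
      ((σ ^ 2)⁻¹ - (σ * a)⁻¹) * B S ^ 2 + ((a ^ 2)⁻¹ - (σ * a)⁻¹) * A S ^ 2 := fun S => by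
    field_simp
    ring
  simp only [expand, bernoulliMean_add, bernoulliMean_const_mul]
  rw [hA, hB]
  field_simp
  ring

theorem bernoulliMean_sq_div_sub_div_le (hx0 : 0 ≤ x) (hx1 : x ≤ 1) {A B : Finset α → ℝ}
    {a σ ε : ℝ} (ha : 0 < a) (hσ : 0 ≤ σ) (hA : bernoulliMean U x (fun S => A S ^ 2) = a ^ 2)
    (hB : bernoulliMean U x (fun S => B S ^ 2) = σ ^ 2)
    (hAB : bernoulliMean U x (fun S => (B S - A S) ^ 2) ≤ a ^ 2 * ε) (hε : ε ≤ 1 / 4) :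
    bernoulliMean U x (fun S => (B S / σ - A S / a) ^ 2) ≤ 2 * ε := by
  have half_le : a / 2 ≤ σ := half_le_of_bernoulliMean_sq_sub_le hx0 hx1 hσ hA hB
    (hAB.trans (by nlinarith))
  have hσ_pos : 0 < σ := (half_pos ha).trans_le half_le
  have mean_nonneg : 0 ≤ bernoulliMean U x (fun S => (B S - A S) ^ 2) :=
    bernoulliMean_nonneg hx0 hx1 fun S _ => sq_nonneg _
  rw [bernoulliMean_sq_div_sub_div ha.ne' hσ_pos.ne' hA hB]
  calc _ ≤ bernoulliMean U x (fun S => (B S - A S) ^ 2) / (σ * a) := by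
        gcongr
        exact sub_le_self _ (sq_nonneg _)
    _ ≤ a ^ 2 * ε / (a / 2 * a) :=
        div_le_div₀ (mean_nonneg.trans hAB) hAB (by positivity) (by gcongr)
    _ = 2 * ε := by field_simp

theorem norm_bernoulliMean_exp_normalized_sub_le (hx0 : 0 ≤ x) (hx1 : x ≤ 1)
    {F : Finset α → ℝ} {m ε s t : ℝ} (hm : 0 < m) (hε : ε ≤ 1 / 4)
    (hs : s ^ 2 = #U * x * (1 - x)) (hs0 : 0 < s) (hst : |t| ≤ s)
    (hF : bernoulliMean U x (fun S =>
      (F S - bernoulliMean U x F - m * (#S - #U * x)) ^ 2) ≤ m ^ 2 * s ^ 2 * ε) :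
    ‖bernoulliMean U x (fun S => Complex.exp ((t * ((F S - bernoulliMean U x F) /
        √(bernoulliMean U x (fun S => (F S - bernoulliMean U x F) ^ 2))) : ℝ) * Complex.I)) -
      Complex.exp (-(t ^ 2 / 2))‖ ≤ |t| * √(2 * ε) + (3 * |t| ^ 3 / s + t ^ 4 / s ^ 2) := by
  set σ := √(bernoulliMean U x (fun S => (F S - bernoulliMean U x F) ^ 2))
  have card_sq : bernoulliMean U x (fun S => (m * (#S - #U * x)) ^ 2) = (m * s) ^ 2 := by
    simp only [mul_pow]
    rw [bernoulliMean_const_mul, bernoulliMean_card_sub_sq, hs]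
    ring
  have centered_sq : bernoulliMean U x (fun S => (F S - bernoulliMean U x F) ^ 2) = σ ^ 2 :=
    (Real.sq_sqrt (bernoulliMean_nonneg hx0 hx1 fun S _ => sq_nonneg _)).symm
  have normalized_close := bernoulliMean_sq_div_sub_div_le hx0 hx1 (mul_pos hm hs0)
    (Real.sqrt_nonneg _) card_sq centered_sq (by rwa [mul_pow]) hε
  simp only [mul_div_mul_left _ _ hm.ne'] at normalized_close
  refine (norm_sub_le_norm_sub_add_norm_sub _ _ _).trans (add_le_add
    ((norm_bernoulliMean_exp_sub_le hx0 hx1 t _ _).trans ?_)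
    (norm_bernoulliMean_exp_normalized_card_sub_le hx0 hx1 hs hs0 hst))
  gcongr

end CharFun

section BinomialRandom

open Finset SimpleGraph

instance discreteMeasurableSpace_simpleGraph {V : Type*} [Finite V] :
    DiscreteMeasurableSpace (SimpleGraph V) := by
  have : MeasurableSingletonClass (SimpleGraph V) := ⟨fun G => by
    have embedding := measurableEmbedding_edgeSet (V := V)
    rw [← Set.preimage_image_eq {G} embedding.injective, Set.image_singleton]
    exact embedding.measurable (measurableSet_singleton _)⟩
  infer_instance

variable {V : Type*} [Fintype V] [DecidableEq V]

theorem integral_binomialRandom {E : Type*} [NormedAddCommGroup E] [NormedSpace ℝ E]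
    [CompleteSpace E] (p : unitInterval) (Φ : SimpleGraph V → E) :
    ∫ G, Φ G ∂binomialRandom V p =
      bernoulliMean (edgesOn univ) p
        (fun S : Finset (Sym2 V) => Φ (fromEdgeSet (S : Set (Sym2 V)))) := by
  classical
  have := Fintype.ofFinite (SimpleGraph V)
  rw [integral_fintype .of_finite, bernoulliMean]
  refine sum_bij' (fun G _ => G.edgeFinset) (fun S _ => fromEdgeSet (S : Set (Sym2 V)))
    (fun G _ => mem_powerset.2 fun e he => mem_edgesOn.2
      ⟨fun _ _ => mem_univ _, G.not_isDiag_of_mem_edgeSet (mem_edgeFinset.1 he)⟩)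
    (fun _ _ => mem_univ _) (fun G _ => by simp) (fun S hS => ?_) (fun G _ => ?_)
  · ext e
    simp only [mem_edgeFinset, edgeSet_fromEdgeSet, Set.mem_sdiff, mem_coe]
    exact and_iff_left_of_imp fun he => (mem_edgesOn.1 (mem_powerset.1 hS he)).2
  · rw [coe_edgeFinset, fromEdgeSet_edgeSet, Measure.real, binomialRandom_singleton, card_edgesOn,
      ← coe_edgeFinset, Set.ncard_coe_finset]
    simp

theorem charFun_map_binomialRandom (p : unitInterval) (X : SimpleGraph V → ℝ) (t : ℝ) :
    charFun ((binomialRandom V p).map X) t = bernoulliMean (edgesOn univ) p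
      (fun S : Finset (Sym2 V) =>
        Complex.exp ((t * X (fromEdgeSet (S : Set (Sym2 V))) : ℝ) * Complex.I)) := by
  rw [charFun_apply_real, integral_map Measurable.of_discrete.aemeasurable (by fun_prop),
    integral_binomialRandom]
  push_cast
  rfl

end BinomialRandom

section Asymptotics

open Topology

variable {i : ℕ} {p : ℕ → unitInterval}

theorem meanInfluence_pos {n i : ℕ} (hn : i + 2 ≤ n) {x : ℝ} (hx : 0 < x) :
    0 < meanInfluence n i x :=
  mul_pos (Nat.cast_pos.2 (Nat.choose_pos (Nat.le_sub_of_add_le hn))) (pow_pos hx _)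

theorem eventually_pos_of_isLittleO {a : ℝ}
    (hlow : (fun n : ℕ => (n : ℝ) ^ a) =o[atTop] fun n => (p n : ℝ)) :
    ∀ᶠ n in atTop, 0 < (p n : ℝ) := by
  filter_upwards [hlow.bound one_pos, eventually_gt_atTop 0] with n rpow_le hn
  rw [one_mul, Real.norm_of_nonneg (p n).2.1] at rpow_le
  exact (norm_pos_iff.2 (Real.rpow_pos_of_pos (Nat.cast_pos.2 hn) a).ne').trans_le rpow_le

theorem rpow_neg_one_div_pow (n : ℕ) {k : ℕ} (hk : k ≠ 0) :
    ((n : ℝ) ^ (-(1 / (k : ℝ)))) ^ k = (n : ℝ)⁻¹ := by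
  rw [one_div, Real.rpow_neg n.cast_nonneg, inv_pow, Real.rpow_inv_natCast_pow n.cast_nonneg hk]

theorem tendsto_mul_pow_atTop {k : ℕ} (hk : k ≠ 0)
    (hlow : (fun n : ℕ => (n : ℝ) ^ (-(1 / (k : ℝ)))) =o[atTop] fun n => (p n : ℝ)) :
    Tendsto (fun n : ℕ => n * (p n : ℝ) ^ k) atTop atTop := by
  have quotient_tendsto := (hlow.pow hk.pos).tendsto_div_nhds_zero
  have quotient_pos : ∀ᶠ n : ℕ in atTop,
      0 < ((n : ℝ) ^ (-(1 / (k : ℝ)))) ^ k / (p n : ℝ) ^ k := by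
    filter_upwards [eventually_pos_of_isLittleO hlow, eventually_gt_atTop 0] with n hp hn
    have : 0 < (n : ℝ) := Nat.cast_pos.2 hn
    positivity
  refine (tendsto_nhdsWithin_iff.2
    ⟨quotient_tendsto, quotient_pos⟩).inv_tendsto_nhdsGT_zero.congr fun n => ?_
  rw [Pi.inv_apply, rpow_neg_one_div_pow n hk, inv_div, div_inv_eq_mul, mul_comm]

theorem tendsto_mul_pow_zero {k : ℕ} (hk : k ≠ 0)
    (hup : (fun n : ℕ => (p n : ℝ)) =o[atTop] fun n => (n : ℝ) ^ (-(1 / (k : ℝ)))) :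
    Tendsto (fun n : ℕ => n * (p n : ℝ) ^ k) atTop (𝓝 0) := by
  refine (hup.pow hk.pos).tendsto_div_nhds_zero.congr fun n => ?_
  rw [rpow_neg_one_div_pow n hk, div_inv_eq_mul, mul_comm]

theorem tendsto_zero_of_isLittleO_rpow {a : ℝ} (ha : 0 < a)
    (hup : (fun n : ℕ => (p n : ℝ)) =o[atTop] fun n => (n : ℝ) ^ (-a)) :
    Tendsto (fun n => (p n : ℝ)) atTop (𝓝 0) :=
  hup.trans_tendsto ((tendsto_rpow_neg_atTop ha).comp tendsto_natCast_atTop_atTop)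

theorem tendsto_linearizationError
    (hw : Tendsto (fun n : ℕ => n * (p n : ℝ) ^ (i + 1)) atTop atTop)
    (hv : Tendsto (fun n : ℕ => n * (p n : ℝ) ^ (i + 2)) atTop (𝓝 0)) :
    Tendsto (fun n => linearizationError n i (p n)) atTop (𝓝 0) := by
  have count_error := hw.const_div_atTop (i * 2 ^ (i + 2) * (2 ^ i * i.factorial) ^ 2)
  have rank_error :=
    (Real.tendsto_sqrt_atTop.comp hw).const_div_atTop (((i + 2).choose 2 : ℝ) + 4)
  have rank_succ_error :=
    ((hv.pow 2).add hv).const_mul (((i : ℝ) + 2) * 2 ^ (i + 3) * (2 ^ i * i.factorial) ^ 2)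
  have total :=
    (((count_error.const_mul 2).add (rank_error.const_mul 2)).add rank_succ_error).const_mul 3
  simp only [mul_zero, add_zero, ne_eq, OfNat.ofNat_ne_zero, not_false_eq_true, zero_pow] at total
  exact total

theorem le_two_mul_choose_two {n : ℕ} (hn : 2 ≤ n) : n ≤ 2 * n.choose 2 := by
  rw [Nat.choose_two_right, Nat.mul_div_cancel' (Nat.even_mul_pred_self n).two_dvd]
  exact Nat.le_mul_of_pos_right n (Nat.sub_pos_of_lt hn)

theorem tendsto_choose_two_mul_mul_one_sub_atTop
    (hw : Tendsto (fun n : ℕ => n * (p n : ℝ) ^ (i + 1)) atTop atTop)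
    (hp : Tendsto (fun n => (p n : ℝ)) atTop (𝓝 0)) :
    Tendsto (fun n : ℕ => n.choose 2 * (p n : ℝ) * (1 - p n)) atTop atTop := by
  refine tendsto_atTop_mono' _ ?_ (hw.const_mul_atTop (by norm_num : (0 : ℝ) < 1 / 4))
  filter_upwards [eventually_ge_atTop 2, hp.eventually_le_const (by norm_num : (0 : ℝ) < 1 / 2)]
    with n hn p_le_half
  have p_nonneg : 0 ≤ (p n : ℝ) := (p n).2.1
  have n_le : (n : ℝ) ≤ 2 * n.choose 2 := by exact_mod_cast le_two_mul_choose_two hn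
  have pow_le : (p n : ℝ) ^ (i + 1) ≤ p n := pow_le_of_le_one p_nonneg (p n).2.2 i.succ_ne_zero
  calc 1 / 4 * (n * (p n : ℝ) ^ (i + 1)) ≤ 1 / 4 * (2 * n.choose 2 * p n) := by gcongr
    _ = n.choose 2 * (p n : ℝ) * (1 / 2) := by ring
    _ ≤ n.choose 2 * (p n : ℝ) * (1 - p n) := by gcongr; linarith

theorem tendsto_gaussian_error_zero {ε s : ℕ → ℝ} (hε : Tendsto ε atTop (𝓝 0))
    (hs : Tendsto s atTop atTop) (t : ℝ) :
    Tendsto (fun n => |t| * √(2 * ε n) + (3 * |t| ^ 3 / s n + t ^ 4 / s n ^ 2)) atTop (𝓝 0) := by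
  have sqrt_tendsto := ((hε.const_mul 2).sqrt).const_mul |t|
  have cubic_tendsto := hs.const_div_atTop (3 * |t| ^ 3)
  have quartic_tendsto := ((tendsto_pow_atTop two_ne_zero).comp hs).const_div_atTop (t ^ 4)
  simpa using sqrt_tendsto.add (cubic_tendsto.add quartic_tendsto)

theorem charFun_normalized_cliqueBetti (n k : ℕ) (p : unitInterval) (t : ℝ) :
    charFun ((SimpleGraph.binomialRandom (Fin n) p).map fun G =>
      (cliqueBetti n k G - ∫ H, cliqueBetti n k H ∂SimpleGraph.binomialRandom (Fin n) p) /
        √(variance (cliqueBetti n k) (SimpleGraph.binomialRandom (Fin n) p))) t =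
      bernoulliMean (edgesOn (Finset.univ : Finset (Fin n))) p (fun S => Complex.exp
        ((t * ((onEdges (cliqueComplexBetti k) S - bernoulliMean
            (edgesOn (Finset.univ : Finset (Fin n))) p (onEdges (cliqueComplexBetti k))) /
          √(bernoulliMean (edgesOn (Finset.univ : Finset (Fin n))) p
            (fun S => (onEdges (cliqueComplexBetti k) S - bernoulliMean
              (edgesOn (Finset.univ : Finset (Fin n))) p
                (onEdges (cliqueComplexBetti k))) ^ 2))) : ℝ) * Complex.I)) := by
  rw [charFun_map_binomialRandom, variance_eq_integral Measurable.of_discrete.aemeasurable,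
    integral_binomialRandom, integral_binomialRandom]
  rfl

theorem tendsto_charFun_normalized_cliqueBetti
    (hw : Tendsto (fun n : ℕ => n * (p n : ℝ) ^ (i + 1)) atTop atTop)
    (hv : Tendsto (fun n : ℕ => n * (p n : ℝ) ^ (i + 2)) atTop (𝓝 0))
    (hp : Tendsto (fun n => (p n : ℝ)) atTop (𝓝 0)) (hpos : ∀ᶠ n in atTop, 0 < (p n : ℝ)) (t : ℝ) :
    Tendsto (fun n => charFun ((SimpleGraph.binomialRandom (Fin n) (p n)).map fun G =>
      (cliqueBetti n (i + 1) G -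
          ∫ H, cliqueBetti n (i + 1) H ∂SimpleGraph.binomialRandom (Fin n) (p n)) /
        √(variance (cliqueBetti n (i + 1)) (SimpleGraph.binomialRandom (Fin n) (p n)))) t) atTop
      (𝓝 (Complex.exp (-(t ^ 2 / 2)))) := by
  have error_tendsto := tendsto_linearizationError hw hv
  have sd_tendsto :=
    Real.tendsto_sqrt_atTop.comp (tendsto_choose_two_mul_mul_one_sub_atTop hw hp)
  refine tendsto_iff_norm_sub_tendsto_zero.2 (squeeze_zero' (.of_forall fun n => norm_nonneg _) ?_
    (tendsto_gaussian_error_zero error_tendsto sd_tendsto t))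
  filter_upwards [eventually_ge_atTop (2 * (i + 2)), hpos, hw.eventually_ge_atTop 1,
    sd_tendsto.eventually_ge_atTop |t|, sd_tendsto.eventually_gt_atTop 0,
    error_tendsto.eventually_le_const (by norm_num : (0 : ℝ) < 1 / 4)]
    with n hn p_pos one_le t_le sd_pos error_le
  have sd_sq : √(n.choose 2 * (p n : ℝ) * (1 - p n)) ^ 2 =
      (edgesOn (Finset.univ : Finset (Fin n))).card * (p n : ℝ) * (1 - p n) := by
    rw [card_edgesOn, Finset.card_univ, Fintype.card_fin]
    exact Real.sq_sqrt (Real.sqrt_pos.1 sd_pos).le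
  rw [charFun_normalized_cliqueBetti]
  refine norm_bernoulliMean_exp_normalized_sub_le p_pos.le (p n).2.2
    (meanInfluence_pos (by omega : i + 2 ≤ n) p_pos) error_le sd_sq sd_pos t_le ?_
  have linearization := bernoulliMean_sq_cliqueComplexBetti_sub_card_le (V := Fin n) (i := i)
    (by rwa [Fintype.card_fin]) p_pos (p n).2.2 (by rwa [Fintype.card_fin])
  simpa only [Function.comp_apply, sd_sq, Fintype.card_fin] using linearization

end Asymptotics

theorem theorem2 (k : ℕ) (hk : 0 < k) (p : ℕ → unitInterval)
    (hlow : (fun n : ℕ => (n : ℝ) ^ (-(1 / (k : ℝ)))) =o[atTop] fun n => (p n : ℝ))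
    (hup : (fun n : ℕ => (p n : ℝ)) =o[atTop] fun n => (n : ℝ) ^ (-(1 / ((k : ℝ) + 1)))) :
    TendstoInDistribution
      (fun (n : ℕ) (G : SimpleGraph (Fin n)) =>
        (cliqueBetti n k G - ∫ H, cliqueBetti n k H ∂SimpleGraph.binomialRandom (Fin n) (p n)) /
          √(variance (cliqueBetti n k) (SimpleGraph.binomialRandom (Fin n) (p n))))
      atTop (id : ℝ → ℝ)
      (fun n => SimpleGraph.binomialRandom (Fin n) (p n)) (gaussianReal 0 1) := by
  obtain ⟨i, rfl⟩ := Nat.exists_eq_add_of_le' hk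
  refine ⟨fun n => Measurable.of_discrete.aemeasurable, by fun_prop,
    ProbabilityMeasure.tendsto_iff_tendsto_charFun.2 fun t => ?_⟩
  have charFun_tendsto := tendsto_charFun_normalized_cliqueBetti
    (tendsto_mul_pow_atTop i.succ_ne_zero hlow)
    (tendsto_mul_pow_zero (i + 1).succ_ne_zero (by exact_mod_cast hup))
    (tendsto_zero_of_isLittleO_rpow (by positivity) hup)
    (eventually_pos_of_isLittleO hlow) t
  simpa [charFun_gaussianReal, neg_div] using charFun_tendsto
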